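/- **Theorem B.** Let $(G_j)_{j\in J}$ be a family of (smooth, real) Lie groups modelled on Hausdorff locally convex real topological vector spaces $E_j$; Lie groups are Hausdorff, and smooth maps are understood in the sense of Bastiani (Keller's $C^\infty_c$-theory). Let $$\bigoplus_{j\in J}G_j:=\Big\{(x_j)_{j\in J}\in\prod_{j\in J}G_j\colon x_j=e\text{ for all but finitely many }j\Big\},$$ and let $\bigoplus_{j\in J}E_j$ carry the locally convex direct sum topology, i.e. the finest locally convex vector topology making all inclusions $E_i\to\bigoplus_{j\in J}E_j$ continuous. The group $\bigoplus_{j\in J}G_j$ can be made a Lie group modelled on $\bigoplus_{j\in J}E_j$, called the weak direct product, in such a way that for some $C^\infty$-diffeomorphisms $\phi_j\colon U_j\to V_j$ from open identity neighbourhoods $U_j\subseteq G_j$ onto open $0$-neighbourhoods $V_j\subseteq E_j$ with $\phi_j(e)=0$, the set $\bigoplus_{j}U_j:=\big(\bigoplus_{j}G_j\big)\cap\prod_{j}U_j$ is open and $$\bigoplus_{j\in J}U_j\to\bigoplus_{j\in J}V_j:=\Big(\bigoplus_{j\in J}E_j\Big)\cap\prod_{j\in J}V_j,\qquad (x_j)_{j\in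 J}\mapsto(\phi_j(x_j))_{j\in J},$$ is a $C^\infty$-diffeomorphism between open sets. For every such Lie group structure on $\bigoplus_{j\in J}G_j$: if each $G_j$ is complete (resp., sequentially complete), then so is $\bigoplus_{j\in J}G_j$. Here a topological group $G$ is called complete (resp., sequentially complete) if every left Cauchy net (resp., left Cauchy sequence) in $G$ converges; a net $(x_\alpha)$ is left Cauchy if for each identity neighbourhood $U$ there is $\gamma$ with $x_\beta^{-1}x_\alpha\in U$ for all $\alpha,\beta\ge\gamma$. -/

import Mathlib

open Filter Topology Set

universe u v w

/-! ### Complete and sequentially complete topological groups -/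

/-- A net `x : A → G` in a topological group is a left Cauchy net if for each identity
neighbourhood `U` there is `γ` with `x β ⁻¹ * x α ∈ U` for all `α, β ≥ γ`. -/
def IsLeftCauchyNet {A : Type w} [Preorder A] {G : Type u} [Group G] [TopologicalSpace G]
    (x : A → G) : Prop :=
  ∀ U ∈ 𝓝 (1 : G), ∃ γ : A, ∀ α β : A, γ ≤ α → γ ≤ β → (x β)⁻¹ * x α ∈ U

/-- A topological group is complete if every left Cauchy net in it converges. The index sets are
taken in the universe of `G`; by `isLeftComplete_iff_filter` and
`IsLeftComplete.exists_tendsto` this is no restriction. -/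
def IsLeftComplete (G : Type u) [Group G] [TopologicalSpace G] : Prop :=
  ∀ (A : Type u) [Preorder A] [IsDirectedOrder A] [Nonempty A] (x : A → G),
    IsLeftCauchyNet x → ∃ g : G, Tendsto x atTop (𝓝 g)

/-- A topological group is sequentially complete if every left Cauchy sequence in it converges. -/
def IsLeftSeqComplete (G : Type u) [Group G] [TopologicalSpace G] : Prop :=
  ∀ x : ℕ → G, IsLeftCauchyNet x → ∃ g : G, Tendsto x atTop (𝓝 g)

/-- Completeness in terms of filters. -/
theorem isLeftComplete_iff_filter (G : Type u) [Group G] [TopologicalSpace G] :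
    IsLeftComplete G ↔ ∀ F : Filter G, F.NeBot →
      (∀ U ∈ 𝓝 (1 : G), ∃ S ∈ F, ∀ a ∈ S, ∀ b ∈ S, b⁻¹ * a ∈ U) → ∃ g : G, F ≤ 𝓝 g := by
  constructor
  · intro h F hF hC
    let A : Type u := {p : Set G × G // p.1 ∈ F ∧ p.2 ∈ p.1}
    let : Preorder A := Preorder.lift fun p : A => OrderDual.toDual p.1.1
    have hle : ∀ p q : A, p ≤ q ↔ q.1.1 ⊆ p.1.1 := fun _ _ => Iff.rfl
    have : IsDirectedOrder A := ⟨fun p q => by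
      obtain ⟨y, hy⟩ := hF.nonempty_of_mem (inter_mem p.2.1 q.2.1)
      exact ⟨⟨(p.1.1 ∩ q.1.1, y), inter_mem p.2.1 q.2.1, hy⟩,
        (hle _ _).2 inter_subset_left, (hle _ _).2 inter_subset_right⟩⟩
    have : Nonempty A := ⟨⟨(univ, 1), univ_mem, mem_univ _⟩⟩
    obtain ⟨g, hg⟩ := h A (fun p => p.1.2) (by
      intro U hU
      obtain ⟨S, hS, hSU⟩ := hC U hU
      obtain ⟨y, hy⟩ := hF.nonempty_of_mem hS
      exact ⟨⟨(S, y), hS, hy⟩, fun α β hα hβ =>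
        hSU _ ((hle _ _).1 hα α.2.2) _ ((hle _ _).1 hβ β.2.2)⟩)
    refine ⟨g, fun V hV => ?_⟩
    obtain ⟨p, hp⟩ := mem_atTop_sets.1 (hg hV)
    exact mem_of_superset p.2.1 fun y hy =>
      hp ⟨(p.1.1, y), p.2.1, hy⟩ ((hle _ _).2 Subset.rfl)
  · intro h A _ _ _ x hx
    refine h (map x atTop) inferInstance fun U hU => ?_
    obtain ⟨γ, hγ⟩ := hx U hU
    refine ⟨x '' Ici γ, image_mem_map (mem_atTop γ), ?_⟩
    rintro _ ⟨α, hα, rfl⟩ _ ⟨β, hβ, rfl⟩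
    exact hγ α β hα hβ

/-- In a complete group, left Cauchy nets indexed by directed sets in any universe converge. -/
theorem IsLeftComplete.exists_tendsto {G : Type u} [Group G] [TopologicalSpace G]
    (h : IsLeftComplete G) {A : Type w} [Preorder A] [IsDirectedOrder A] [Nonempty A]
    (x : A → G) (hx : IsLeftCauchyNet x) : ∃ g : G, Tendsto x atTop (𝓝 g) := by
  refine (isLeftComplete_iff_filter G).1 h (map x atTop) inferInstance fun U hU => ?_
  obtain ⟨γ, hγ⟩ := hx U hU
  refine ⟨x '' Ici γ, image_mem_map (mem_atTop γ), ?_⟩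
  rintro _ ⟨α, hα, rfl⟩ _ ⟨β, hβ, rfl⟩
  exact hγ α β hα hβ

/-! ### Smooth maps between open subsets of locally convex spaces -/

/-- `C^n`-maps on an open set `U` in the sense of Bastiani (Keller's `C^n_c`-theory): `f` is `C^0`
if it is continuous, and `C^(n+1)` if it is continuous, the directional derivatives
`df (x, y) = lim (f (x + t y) - f x) / t` exist for all `x ∈ U` and all directions `y`, and
`df` is `C^n` on the open subset `U × E` of `E × E`. -/
def BastianiOn {F : Type v} [AddCommGroup F] [Module ℝ F] [TopologicalSpace F] :
    ℕ → ∀ {E : Type u} [AddCommGroup E] [Module ℝ E] [TopologicalSpace E],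
      (E → F) → Set E → Prop
  | 0, _, _, _, _, f, U => ContinuousOn f U
  | n + 1, E, _, _, _, f, U => ContinuousOn f U ∧ ∃ df : E × E → F,
      (∀ x ∈ U, ∀ y : E,
        Tendsto (fun t : ℝ => t⁻¹ • (f (x + t • y) - f x)) (𝓝[≠] 0) (𝓝 (df (x, y)))) ∧
      BastianiOn n df (U ×ˢ (univ : Set E))

/-- Smooth (`C^∞`) maps on an open subset of a locally convex space. -/
def BastianiSmoothOn {E : Type u} [AddCommGroup E] [Module ℝ E] [TopologicalSpace E]
    {F : Type v} [AddCommGroup F] [Module ℝ F] [TopologicalSpace F]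
    (f : E → F) (U : Set E) : Prop :=
  ∀ n : ℕ, BastianiOn n f U

/-! ### Lie groups modelled on locally convex spaces -/

/-- `G`, with its given topology, atlas and group structure, is a (smooth, real) Lie group modelled
on the topological vector space `E`: a Hausdorff topological group whose changes of charts are
smooth and whose multiplication and inversion are smooth in charts. -/
structure IsLocallyConvexLieGroup (E : Type u) [AddCommGroup E] [Module ℝ E] [TopologicalSpace E]
    (G : Type v) [Group G] [TopologicalSpace G] [ChartedSpace E G] : Prop where
  t2 : T2Space G
  topologicalGroup : IsTopologicalGroup G
  smooth_transition : ∀ e ∈ atlas E G, ∀ e' ∈ atlas E G,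
    BastianiSmoothOn (fun v : E => e' (e.symm v))
      {v : E | v ∈ e.target ∧ e.symm v ∈ e'.source}
  smooth_mul : ∀ e₁ ∈ atlas E G, ∀ e₂ ∈ atlas E G, ∀ e₃ ∈ atlas E G,
    BastianiSmoothOn (fun p : E × E => e₃ (e₁.symm p.1 * e₂.symm p.2))
      {p : E × E | p.1 ∈ e₁.target ∧ p.2 ∈ e₂.target ∧ e₁.symm p.1 * e₂.symm p.2 ∈ e₃.source}
  smooth_inv : ∀ e₁ ∈ atlas E G, ∀ e₂ ∈ atlas E G,
    BastianiSmoothOn (fun v : E => e₂ (e₁.symm v)⁻¹)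
      {v : E | v ∈ e₁.target ∧ (e₁.symm v)⁻¹ ∈ e₂.source}

/-- A homeomorphism `φ` from an open subset of the manifold `M` onto an open subset of its modelling
space `E` is a `C^∞`-diffeomorphism if `φ` and `φ⁻¹` are smooth in the charts of `M`. -/
def IsSmoothDiffeo {E : Type u} [AddCommGroup E] [Module ℝ E] [TopologicalSpace E]
    {M : Type v} [TopologicalSpace M] [ChartedSpace E M] (φ : OpenPartialHomeomorph M E) : Prop :=
  ∀ e ∈ atlas E M,
    BastianiSmoothOn (fun v : E => φ (e.symm v)) {v : E | v ∈ e.target ∧ e.symm v ∈ φ.source} ∧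
    BastianiSmoothOn (fun v : E => e (φ.symm v)) {v : E | v ∈ φ.target ∧ φ.symm v ∈ e.source}

/-! ### The locally convex direct sum -/

section LCDirectSum

variable {J : Type w} (E : J → Type u) [∀ j, AddCommGroup (E j)]

/-- The direct sum `⨁ j, E j`, to be given the locally convex direct sum topology. -/
def LCDirectSum : Type (max w u) := Π₀ j, E j

noncomputable instance LCDirectSum.instAddCommGroup :
    AddCommGroup (LCDirectSum E) := inferInstanceAs (AddCommGroup (Π₀ j, E j))

noncomputable instance LCDirectSum.instModule [∀ j, Module ℝ (E j)] : Module ℝ (LCDirectSum E) :=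
  inferInstanceAs (Module ℝ (Π₀ j, E j))

instance : CoeFun (LCDirectSum E) (fun _ => ∀ j, E j) := ⟨fun x => DFunLike.coe (F := Π₀ j, E j) x⟩

open Classical in
/-- The inclusion of `E j` into the direct sum. -/
noncomputable def LCDirectSum.incl [∀ j, Module ℝ (E j)] (j : J) : E j →ₗ[ℝ] LCDirectSum E :=
  DFinsupp.lsingle (R := ℝ) (M := E) j

/-- The coordinate map into the full product. -/
def LCDirectSum.toPi [∀ j, Module ℝ (E j)] : LCDirectSum E →ₗ[ℝ] (∀ j, E j) :=
  DFinsupp.coeFnLinearMap ℝ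

theorem LCDirectSum.toPi_apply [∀ j, Module ℝ (E j)] (x : LCDirectSum E) (j : J) :
    LCDirectSum.toPi E x j = x j := rfl

theorem LCDirectSum.toPi_injective [∀ j, Module ℝ (E j)] :
    Function.Injective (LCDirectSum.toPi E) := fun x y h =>
  DFunLike.coe_injective (F := Π₀ j, E j) (a₁ := x) (a₂ := y) h

theorem LCDirectSum.toPi_incl_same [∀ j, Module ℝ (E j)] (j : J) (x : E j) :
    LCDirectSum.toPi E (LCDirectSum.incl E j x) j = x := by
  classical
  exact (DFinsupp.single_apply (β := E)).trans (dif_pos rfl)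

theorem LCDirectSum.toPi_incl_of_ne [∀ j, Module ℝ (E j)] {i j : J} (h : j ≠ i) (x : E j) :
    LCDirectSum.toPi E (LCDirectSum.incl E j x) i = 0 := by
  classical
  exact (DFinsupp.single_apply (β := E)).trans (dif_neg h)

variable [∀ j, Module ℝ (E j)] [∀ j, TopologicalSpace (E j)]

/-- `t` is a locally convex vector topology on the direct sum for which all inclusions
`E j → ⨁ j, E j` are continuous. -/
structure LCDirectSum.IsAdmissible (t : TopologicalSpace (LCDirectSum E)) : Prop where
  add : @IsTopologicalAddGroup (LCDirectSum E) t _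
  smul : @ContinuousSMul ℝ (LCDirectSum E) _ _ t
  convex : @LocallyConvexSpace ℝ (LCDirectSum E) _ _ _ _ t
  incl : ∀ j, @Continuous _ _ _ t (LCDirectSum.incl E j)

/-- The locally convex direct sum topology: the finest locally convex vector topology for which all
inclusions are continuous (in Mathlib's order on topologies, finer means smaller). -/
instance LCDirectSum.topology : TopologicalSpace (LCDirectSum E) :=
  sInf {t | LCDirectSum.IsAdmissible E t}

instance LCDirectSum.instIsTopologicalAddGroup :
    IsTopologicalAddGroup (LCDirectSum E) := topologicalAddGroup_sInf fun _ ht => ht.add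

instance LCDirectSum.instContinuousSMul :
    ContinuousSMul ℝ (LCDirectSum E) := continuousSMul_sInf fun _ ht => ht.smul

instance LCDirectSum.instLocallyConvexSpace :
    LocallyConvexSpace ℝ (LCDirectSum E) :=
  LocallyConvexSpace.sInf fun _ ht => ht.convex

theorem LCDirectSum.continuous_incl (j : J) : Continuous (LCDirectSum.incl E j) :=
  continuous_sInf_rng.2 fun _ ht => ht.incl j

/-- The defining property: the direct sum topology is admissible, and finer than every admissible
topology. -/
theorem LCDirectSum.topology_isLeast : IsLeast {t | LCDirectSum.IsAdmissible E t}
    (LCDirectSum.topology E) :=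
  ⟨⟨inferInstance, inferInstance, inferInstance, LCDirectSum.continuous_incl E⟩,
    fun _ ht => sInf_le ht⟩

theorem LCDirectSum.continuous_toPi [∀ j, IsTopologicalAddGroup (E j)]
    [∀ j, ContinuousSMul ℝ (E j)] [∀ j, LocallyConvexSpace ℝ (E j)] :
    Continuous (LCDirectSum.toPi E) := by
  classical
  refine continuous_iff_le_induced.2 (sInf_le ⟨topologicalAddGroup_induced _,
    continuousSMul_induced _, LocallyConvexSpace.induced _, fun j => continuous_induced_rng.2 ?_⟩)
  refine continuous_pi fun i => ?_
  rcases eq_or_ne j i with rfl | h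
  · exact continuous_id.congr fun x => (LCDirectSum.toPi_incl_same E j x).symm
  · exact (continuous_const (y := (0 : E i))).congr fun x =>
      (LCDirectSum.toPi_incl_of_ne E h x).symm

instance LCDirectSum.instT2Space [∀ j, IsTopologicalAddGroup (E j)]
    [∀ j, ContinuousSMul ℝ (E j)]
    [∀ j, LocallyConvexSpace ℝ (E j)] [∀ j, T2Space (E j)] : T2Space (LCDirectSum E) :=
  T2Space.of_injective_continuous (f := LCDirectSum.toPi E)
    (LCDirectSum.toPi_injective E) (LCDirectSum.continuous_toPi E)

end LCDirectSum

/-! ### The weak direct product -/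

section WeakDirectProduct

variable {J : Type w} (G : J → Type v) [∀ j, Group (G j)]

/-- The subgroup of the full product formed by the families `x` with `x j = 1` for all but finitely
many `j`. -/
def finiteSupportSubgroup : Subgroup (∀ j, G j) where
  carrier := {x | {j | x j ≠ 1}.Finite}
  one_mem' := by simp
  mul_mem' := by
    intro x y hx hy
    refine (hx.union hy).subset fun j hj => ?_
    by_contra h
    simp only [mem_union, mem_ofPred_eq, not_or, not_not] at h
    exact hj (by simp [h.1, h.2])
  inv_mem' := by
    intro x hx
    simpa using hx

/-- The group underlying the weak direct product. It is a type of its own, so that it does not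
inherit the subspace topology of the full product. -/
def WeakDirectProduct : Type (max w v) := finiteSupportSubgroup G

instance WeakDirectProduct.instGroup : Group (WeakDirectProduct G) :=
  inferInstanceAs (Group (finiteSupportSubgroup G))

instance : CoeFun (WeakDirectProduct G) (fun _ => ∀ j, G j) :=
  ⟨fun x => Subtype.val (p := fun y => y ∈ finiteSupportSubgroup G) x⟩

/-- The given topology and atlas on the group `⨁ j, G j` make it the weak direct product of the Lie
groups `G j`: it is a Lie group modelled on the locally convex direct sum `⨁ j, E j` such that, for
some `C^∞`-diffeomorphisms `φ j` from open identity neighbourhoods `U j ⊆ G j` onto open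
`0`-neighbourhoods `V j ⊆ E j` with `φ j 1 = 0`, the set `⨁ j, U j` is open and
`(x j) ↦ (φ j (x j))` is a `C^∞`-diffeomorphism from it onto the open set `⨁ j, V j`. -/
structure IsWeakDirectProductLieGroup (E : J → Type u)
    [∀ j, AddCommGroup (E j)] [∀ j, Module ℝ (E j)] [∀ j, TopologicalSpace (E j)]
    [∀ j, TopologicalSpace (G j)] [∀ j, ChartedSpace (E j) (G j)]
    [TopologicalSpace (WeakDirectProduct G)]
    [ChartedSpace (LCDirectSum E) (WeakDirectProduct G)] : Prop where
  isLieGroup : IsLocallyConvexLieGroup (LCDirectSum E) (WeakDirectProduct G)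
  exists_chart : ∃ (φ : ∀ j, OpenPartialHomeomorph (G j) (E j))
    (Φ : OpenPartialHomeomorph (WeakDirectProduct G) (LCDirectSum E)),
    (∀ j, (1 : G j) ∈ (φ j).source ∧ φ j 1 = 0 ∧ IsSmoothDiffeo (φ j)) ∧
    Φ.source = {x | ∀ j, x j ∈ (φ j).source} ∧
    Φ.target = {v | ∀ j, v j ∈ (φ j).target} ∧
    (∀ x ∈ Φ.source, ∀ j, Φ x j = φ j (x j)) ∧
    IsSmoothDiffeo Φ

end WeakDirectProduct

/-! ### Continuous seminorms on locally convex spaces -/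

section Seminorms

variable {E : Type*} [AddCommGroup E] [Module ℝ E] [TopologicalSpace E]

/-! The topology of `⨁ j, E j` is governed by the seminorms `z ↦ ∑ j, q j (z j)` with all `q j`
continuous: they are continuous (`continuous_sumSeminorm`) and dominate every continuous seminorm
(`le_sumSeminorm_comp_incl`).

Existence. The charts are direct sums of charts of the `G j`, almost all of them sending `1` to `0`.
Transition maps and group operations then become direct sums of smooth maps, almost all of which fix
`0`. Such a sum is smooth (`BastianiOn.directSum`). The point is continuity: a `C^1`-map `f` fixing
`0` satisfies `p (f y) ≤ q y` near `0` for some continuous seminorm `q` (`exists_seminorm_sub_le`),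
and these estimates can be added over infinitely many coordinates. Derivatives are again direct sums
of maps almost all of which fix `0`, so induction applies.

Completeness. The coordinates of a left Cauchy net are left Cauchy, hence converge. The family of
limits has finite support because boxes `∏ W j` with arbitrary identity neighbourhoods `W j` trace
out identity neighbourhoods. The net converges to that family because identity neighbourhoods can be
chosen closed under coordinatewise limits (`exists_mem_nhds_one_forall_tendsto`): a bound on `∑ j, q
j (z j)` is a bound on all finite partial sums, and each of these passes to the limit. -/

theorem exists_continuous_seminorm_ball_subset [IsTopologicalAddGroup E] [ContinuousSMul ℝ E]
    [LocallyConvexSpace ℝ E] {U : Set E} (hU : U ∈ 𝓝 (0 : E)) :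
    ∃ p : Seminorm ℝ E, Continuous p ∧ ∀ x, p x < 1 → x ∈ U := by
  obtain ⟨s, hs, hsU⟩ := (nhds_hasBasis_absConvex_open ℝ E).mem_iff.1 hU
  refine ⟨gaugeSeminormFamily ℝ E ⟨s, hs⟩,
    (with_gaugeSeminormFamily (𝕜 := ℝ) (E := E)).continuous_seminorm _,
    fun x hx => hsU ?_⟩
  have h := gaugeSeminormFamily_ball (𝕜 := ℝ) (E := E) ⟨s, hs⟩
  have hx' : x ∈ (gaugeSeminormFamily ℝ E ⟨s, hs⟩).ball 0 1 := by
    rwa [Seminorm.mem_ball_zero]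
  rw [h] at hx'
  exact hx'

theorem exists_continuous_seminorm_of_mem_nhds [IsTopologicalAddGroup E] [ContinuousSMul ℝ E]
    [LocallyConvexSpace ℝ E] {x : E} {U : Set E} (hU : U ∈ 𝓝 x) :
    ∃ p : Seminorm ℝ E, Continuous p ∧ ∀ y, p (y - x) < 1 → y ∈ U := by
  have h : (fun z => z + x) ⁻¹' U ∈ 𝓝 (0 : E) :=
    (continuous_id.add continuous_const).continuousAt.preimage_mem_nhds (by simpa using hU)
  obtain ⟨p, hp, hpU⟩ := exists_continuous_seminorm_ball_subset h
  exact ⟨p, hp, fun y hy => by simpa using hpU _ hy⟩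

theorem tendsto_of_seminorm [IsTopologicalAddGroup E] [ContinuousSMul ℝ E]
    [LocallyConvexSpace ℝ E] {X : Type*} {l : Filter X} {f : X → E} {a : E}
    (h : ∀ p : Seminorm ℝ E, Continuous p → Tendsto (fun x => p (f x - a)) l (𝓝 0)) :
    Tendsto f l (𝓝 a) := by
  intro U hU
  obtain ⟨p, hp, hpU⟩ := exists_continuous_seminorm_of_mem_nhds hU
  exact ((h p hp).eventually (gt_mem_nhds one_pos)).mono fun x hx => hpU _ hx

theorem Filter.Tendsto.seminorm_sub [IsTopologicalAddGroup E] {p : Seminorm ℝ E}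
    (hp : Continuous p) {X : Type*} {l : Filter X} {f : X → E} {a : E}
    (h : Tendsto f l (𝓝 a)) : Tendsto (fun x => p (f x - a)) l (𝓝 0) := by
  have := (hp.tendsto (a - a)).comp (h.sub_const a)
  simpa [Function.comp_def] using this

/-- The topology defined by a single seminorm. -/
theorem Seminorm.exists_topology {X : Type*} [AddCommGroup X] [Module ℝ X] (p : Seminorm ℝ X) :
    ∃ _ : TopologicalSpace X, IsTopologicalAddGroup X ∧ ContinuousSMul ℝ X ∧
      LocallyConvexSpace ℝ X ∧ Continuous p ∧ ∀ {F : Type v} [AddCommGroup F] [Module ℝ F]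
        [TopologicalSpace F] [IsTopologicalAddGroup F] (T : F →ₗ[ℝ] X),
        Continuous (fun x => p (T x)) → Continuous T := by
  let P : SeminormFamily ℝ X Unit := fun _ => p
  let := P.moduleFilterBasis.topology
  have hP : WithSeminorms P := ⟨rfl⟩
  have := hP.topologicalAddGroup
  refine ⟨inferInstance, inferInstance, hP.continuousSMul, hP.toLocallyConvexSpace,
    hP.continuous_seminorm (), fun {F} _ _ _ _ T hT => ?_⟩
  rw [continuous_iff_continuousAt]
  intro x
  refine (hP.tendsto_nhds _ _).2 fun _ ε hε => ?_
  have h := (Filter.Tendsto.seminorm_sub (p := p.comp T) hT (tendsto_id (x := 𝓝 x))).eventually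
    (gt_mem_nhds hε)
  filter_upwards [h] with y hy
  rw [← map_sub]
  exact hy

end Seminorms

/-! ### Seminorms and continuity on the locally convex direct sum -/

namespace LCDirectSum

/-! ### Finitely supported families and sums of seminorms. -/

section Algebra

variable {J : Type w} {E : J → Type u} [∀ j, AddCommGroup (E j)]

theorem ext {z z' : LCDirectSum E} (h : ∀ j, z j = z' j) : z = z' :=
  DFinsupp.ext (β := E) h

@[simp] theorem add_apply (z z' : LCDirectSum E) (j : J) : (z + z') j = z j + z' j :=
  DFinsupp.add_apply (β := E) z z' j

@[simp] theorem sub_apply (z z' : LCDirectSum E) (j : J) : (z - z') j = z j - z' j :=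
  DFinsupp.sub_apply (β := E) z z' j

@[simp] theorem smul_apply [∀ j, Module ℝ (E j)] (c : ℝ) (z : LCDirectSum E) (j : J) :
    (c • z) j = c • z j :=
  DFinsupp.smul_apply (β := E) c z j

theorem finite_support (z : LCDirectSum E) : {j | z j ≠ 0}.Finite := by
  classical
  exact DFinsupp.finite_support (β := E) z

theorem exists_apply_eq {g : ∀ j, E j} (h : ∀ᶠ j in cofinite, g j = 0) :
    ∃ z : LCDirectSum E, ∀ j, z j = g j := by
  classical
  have h' : {j | g j ≠ 0}.Finite := h
  refine ⟨DFinsupp.mk (β := E) h'.toFinset fun j => g j, fun j => ?_⟩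
  refine (DFinsupp.mk_apply (β := E)).trans ?_
  split_ifs with hj
  · rfl
  · simpa [eq_comm] using hj

theorem eventually_apply_eq_zero (z : LCDirectSum E) : ∀ᶠ j in cofinite, z j = 0 :=
  z.finite_support

variable [∀ j, Module ℝ (E j)]

theorem incl_apply_same (j : J) (x : E j) : incl E j x j = x := toPi_incl_same E j x

theorem incl_apply_of_ne {i j : J} (h : j ≠ i) (x : E j) : incl E j x i = 0 :=
  toPi_incl_of_ne E h x

theorem eq_sum_incl (z : LCDirectSum E) {s : Finset J} (hs : ∀ j, z j ≠ 0 → j ∈ s) :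
    z = ∑ j ∈ s, incl E j (z j) := by
  classical
  apply toPi_injective E
  ext i
  rw [map_sum, Finset.sum_apply]
  by_cases hi : i ∈ s
  · rw [Finset.sum_eq_single i, toPi_incl_same]
    · rfl
    · exact fun j _ hj => toPi_incl_of_ne E hj _
    · exact fun h => absurd hi h
  · rw [Finset.sum_eq_zero]
    · by_contra h
      exact hi (hs i h)
    · rintro j hj
      exact toPi_incl_of_ne E (by rintro rfl; exact hi hj) _

theorem finsum_seminorm_eq_sum (q : ∀ j, Seminorm ℝ (E j)) (z : LCDirectSum E) {s : Finset J}
    (hs : ∀ j, z j ≠ 0 → j ∈ s) : ∑ᶠ j, q j (z j) = ∑ j ∈ s, q j (z j) := by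
  refine finsum_eq_sum_of_support_subset _ fun j hj => hs j fun h => hj ?_
  simp [h]

/-- The seminorm `z ↦ ∑ j, q j (z j)` on the direct sum. -/
noncomputable def sumSeminorm (q : ∀ j, Seminorm ℝ (E j)) : Seminorm ℝ (LCDirectSum E) :=
  Seminorm.of (fun z => ∑ᶠ j, q j (z j))
    (fun z z' => by
      classical
      set s := z.finite_support.toFinset ∪ z'.finite_support.toFinset
      have h1 : ∀ j, z j ≠ 0 → j ∈ s := fun j hj => by simp [s, hj]
      have h2 : ∀ j, z' j ≠ 0 → j ∈ s := fun j hj => by simp [s, hj]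
      rw [finsum_seminorm_eq_sum q z h1, finsum_seminorm_eq_sum q z' h2,
        finsum_seminorm_eq_sum q (z + z') (s := s), ← Finset.sum_add_distrib]
      · refine Finset.sum_le_sum fun j _ => ?_
        rw [add_apply]
        exact map_add_le_add _ _ _
      · intro j hj
        by_contra h
        have a1 : z j = 0 := by by_contra h'; exact h (h1 j h')
        have a2 : z' j = 0 := by by_contra h'; exact h (h2 j h')
        exact hj (by rw [add_apply, a1, a2, add_zero]))
    (fun c z => by
      simp only [smul_apply, map_smul_eq_mul]
      rw [mul_finsum])

theorem sumSeminorm_apply (q : ∀ j, Seminorm ℝ (E j)) (z : LCDirectSum E) :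
    sumSeminorm q z = ∑ᶠ j, q j (z j) := rfl

theorem sumSeminorm_eq_sum (q : ∀ j, Seminorm ℝ (E j)) (z : LCDirectSum E) {s : Finset J}
    (hs : ∀ j, z j ≠ 0 → j ∈ s) : sumSeminorm q z = ∑ j ∈ s, q j (z j) :=
  finsum_seminorm_eq_sum q z hs

theorem sum_le_sumSeminorm (q : ∀ j, Seminorm ℝ (E j)) (z : LCDirectSum E) (s : Finset J) :
    ∑ j ∈ s, q j (z j) ≤ sumSeminorm q z := by
  classical
  rw [sumSeminorm_eq_sum q z (s := s ∪ z.finite_support.toFinset) fun j hj => by simp [hj]]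
  exact Finset.sum_le_sum_of_subset_of_nonneg Finset.subset_union_left
    fun _ _ _ => apply_nonneg _ _

theorem apply_le_sumSeminorm (q : ∀ j, Seminorm ℝ (E j)) (z : LCDirectSum E) (j : J) :
    q j (z j) ≤ sumSeminorm q z := by
  simpa using sum_le_sumSeminorm q z {j}

/-- This is the triangle inequality for the finite sum of the `incl E j (z j)`. Together with
`continuous_sumSeminorm`, it reduces every estimate in the direct sum to coordinatewise ones. -/
theorem le_sumSeminorm_comp_incl (p : Seminorm ℝ (LCDirectSum E)) (z : LCDirectSum E) :
    p z ≤ sumSeminorm (fun j => p.comp (incl E j)) z := by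
  have hs : ∀ j, z j ≠ 0 → j ∈ z.finite_support.toFinset := fun j hj => by simp [hj]
  rw [sumSeminorm_eq_sum _ z hs]
  conv_lhs => rw [eq_sum_incl z hs]
  exact Finset.le_sum_of_subadditive p (map_zero p).le (map_add_le_add p) _ _

theorem sumSeminorm_incl (q : ∀ j, Seminorm ℝ (E j)) (j : J) (x : E j) :
    sumSeminorm q (incl E j x) = q j x := by
  rw [sumSeminorm_eq_sum q _ (s := {j}), Finset.sum_singleton, incl_apply_same]
  intro i hi
  by_contra h
  exact hi (incl_apply_of_ne (by simpa [eq_comm] using h) x)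

end Algebra

/-! ### The direct sum topology. -/

variable {J : Type w} {E : J → Type u} [∀ j, AddCommGroup (E j)] [∀ j, Module ℝ (E j)]
  [∀ j, TopologicalSpace (E j)]

/-- The universal property of the locally convex direct sum topology. -/
theorem continuous_of_comp_incl {X : Type*} [AddCommGroup X] [Module ℝ X] [TopologicalSpace X]
    [IsTopologicalAddGroup X] [ContinuousSMul ℝ X] [LocallyConvexSpace ℝ X]
    (T : LCDirectSum E →ₗ[ℝ] X) (h : ∀ j, Continuous fun x => T (incl E j x)) : Continuous T :=
  continuous_iff_le_induced.2 (sInf_le ⟨topologicalAddGroup_induced _,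
    continuousSMul_induced _, LocallyConvexSpace.induced _, fun j => continuous_induced_rng.2 (h j)⟩)

/-- The topology defined by the single seminorm `sumSeminorm q` is admissible, since this seminorm
restricts to `q j` on each summand. The direct sum topology is finer. -/
theorem continuous_sumSeminorm [∀ j, IsTopologicalAddGroup (E j)] {q : ∀ j, Seminorm ℝ (E j)}
    (hq : ∀ j, Continuous (q j)) : Continuous (sumSeminorm q) := by
  obtain ⟨t, hadd, hsmul, hconv, hp, ht⟩ := (sumSeminorm q).exists_topology
  refine continuous_le_dom (sInf_le (⟨hadd, hsmul, hconv, fun j => ht (incl E j) ?_⟩ :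
    IsAdmissible E t)) hp
  simpa only [sumSeminorm_incl] using hq j

theorem continuous_apply [∀ j, IsTopologicalAddGroup (E j)]
    [∀ j, ContinuousSMul ℝ (E j)] [∀ j, LocallyConvexSpace ℝ (E j)] (j : J) :
    Continuous fun z : LCDirectSum E => z j :=
  (_root_.continuous_apply j).comp (continuous_toPi E)

/-- Sets of the form `⨁ j, V j` are open. -/
theorem isOpen_setOf_forall [∀ j, IsTopologicalAddGroup (E j)] [∀ j, ContinuousSMul ℝ (E j)]
    [∀ j, LocallyConvexSpace ℝ (E j)] {V : ∀ j, Set (E j)} (hV : ∀ j, IsOpen (V j)) :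
    IsOpen {z : LCDirectSum E | ∀ j, z j ∈ V j} := by
  rw [isOpen_iff_mem_nhds]
  intro z hz
  choose q hq hqV using fun j => exists_continuous_seminorm_of_mem_nhds ((hV j).mem_nhds (hz j))
  have := (Filter.Tendsto.seminorm_sub (continuous_sumSeminorm hq) (tendsto_id (x := 𝓝 z))).eventually
    (gt_mem_nhds one_pos)
  filter_upwards [this] with y hy j
  -- A sum less than `1` forces each term to be less than `1`, so one seminorm controls all
  -- coordinates.
  refine hqV j _ (lt_of_le_of_lt ?_ hy)
  rw [← sub_apply]
  exact apply_le_sumSeminorm q _ j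

/-- Continuity of the combination of two continuous linear maps into direct sums. -/
theorem exists_prod_continuousLinearMap {E' : J → Type u}
    [∀ j, AddCommGroup (E' j)] [∀ j, Module ℝ (E' j)] [∀ j, TopologicalSpace (E' j)]
    [∀ j, IsTopologicalAddGroup (E j)] [∀ j, ContinuousSMul ℝ (E j)]
    [∀ j, LocallyConvexSpace ℝ (E j)]
    [∀ j, IsTopologicalAddGroup (E' j)] [∀ j, ContinuousSMul ℝ (E' j)]
    [∀ j, LocallyConvexSpace ℝ (E' j)] :
    ∃ T : (LCDirectSum E × LCDirectSum E') →L[ℝ] LCDirectSum (fun j => E j × E' j),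
      ∀ z z' j, T (z, z') j = (z j, z' j) := by
  let T₁ : LCDirectSum E →ₗ[ℝ] LCDirectSum (fun j => E j × E' j) :=
    DFinsupp.mapRange.linearMap fun j => LinearMap.inl ℝ (E j) (E' j)
  let T₂ : LCDirectSum E' →ₗ[ℝ] LCDirectSum (fun j => E j × E' j) :=
    DFinsupp.mapRange.linearMap fun j => LinearMap.inr ℝ (E j) (E' j)
  have a₁ : ∀ z j, T₁ z j = (z j, 0) := fun z j =>
    DFinsupp.mapRange_apply (β₁ := E) (β₂ := fun j => E j × E' j)
      (fun j => LinearMap.inl ℝ (E j) (E' j)) (fun _ => map_zero _) z j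
  have a₂ : ∀ z j, T₂ z j = (0, z j) := fun z j =>
    DFinsupp.mapRange_apply (β₁ := E') (β₂ := fun j => E j × E' j)
      (fun j => LinearMap.inr ℝ (E j) (E' j)) (fun _ => map_zero _) z j
  have h₁ : Continuous T₁ := by
    refine continuous_of_comp_incl T₁ fun j => ?_
    have : (fun x => T₁ (incl E j x)) = fun x => incl (fun j => E j × E' j) j (x, 0) := by
      ext x
      refine ext fun i => ?_
      rw [a₁]
      rcases eq_or_ne j i with rfl | h
      · rw [incl_apply_same, incl_apply_same]
      · rw [incl_apply_of_ne h, incl_apply_of_ne h]; rfl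
    rw [this]
    exact (continuous_incl _ j).comp (continuous_id.prodMk continuous_const)
  have h₂ : Continuous T₂ := by
    refine continuous_of_comp_incl T₂ fun j => ?_
    have : (fun x => T₂ (incl E' j x)) = fun x => incl (fun j => E j × E' j) j (0, x) := by
      ext x
      refine ext fun i => ?_
      rw [a₂]
      rcases eq_or_ne j i with rfl | h
      · rw [incl_apply_same, incl_apply_same]
      · rw [incl_apply_of_ne h, incl_apply_of_ne h]; rfl
    rw [this]
    exact (continuous_incl _ j).comp (continuous_const.prodMk continuous_id)
  refine ⟨⟨T₁.coprod T₂, ?_⟩, fun z z' j => ?_⟩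
  · exact (h₁.comp continuous_fst).add (h₂.comp continuous_snd)
  · change (T₁ z + T₂ z') j = _
    rw [add_apply, a₁, a₂]
    simp

end LCDirectSum

/-! ### Bastiani calculus -/

section Bastiani

variable {E : Type u} [AddCommGroup E] [Module ℝ E] [TopologicalSpace E]
  {F : Type v} [AddCommGroup F] [Module ℝ F] [TopologicalSpace F]

theorem BastianiOn.continuousOn {n : ℕ} {f : E → F} {U : Set E} (h : BastianiOn n f U) :
    ContinuousOn f U := by
  cases n with
  | zero => exact h
  | succ n => exact h.1

/-- Translations in the source and in the target preserve `C^n`-maps. -/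
theorem BastianiOn.translate {F : Type v} [AddCommGroup F] [Module ℝ F] [TopologicalSpace F]
    [IsTopologicalAddGroup F] (n : ℕ) :
    ∀ {E : Type u} [AddCommGroup E] [Module ℝ E] [TopologicalSpace E] [IsTopologicalAddGroup E]
      {f : E → F} {U : Set E}, BastianiOn n f U → ∀ (c : E) (d : F),
      BastianiOn n (fun x => f (x + c) + d) {x | x + c ∈ U} := by
  induction n with
  | zero =>
    intro E _ _ _ _ f U h c d
    refine ContinuousOn.add (ContinuousOn.comp (t := U) h ?_ fun x hx => hx) continuousOn_const
    exact (continuous_id.add continuous_const).continuousOn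
  | succ n ih =>
    intro E _ _ _ _ f U h c d
    obtain ⟨hc, df, hdf, hn⟩ := h
    -- Only the base point is shifted, not the direction; `+ 0` gives the derivative the shape
    -- required by the induction hypothesis.
    refine ⟨?_, fun p => df (p + (c, 0)) + 0, fun x hx y => ?_, ?_⟩
    · refine ContinuousOn.add (ContinuousOn.comp (t := U) hc ?_ fun x hx => hx) continuousOn_const
      exact (continuous_id.add continuous_const).continuousOn
    · have := hdf (x + c) hx y
      simpa [add_right_comm x] using this
    · have := ih hn (c, 0) 0
      convert this using 1
      ext p
      simp

/-- Scaling the direction scales a directional derivative. -/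
theorem directionalDeriv_smul {E F : Type*} [AddCommGroup E] [Module ℝ E] [AddCommGroup F]
    [Module ℝ F] [TopologicalSpace F] [T2Space F] [ContinuousSMul ℝ F] {f : E → F} {x y : E} {a b : F}
    {s : ℝ} (hs : s ≠ 0)
    (ha : Tendsto (fun t : ℝ => t⁻¹ • (f (x + t • y) - f x)) (𝓝[≠] 0) (𝓝 a))
    (hb : Tendsto (fun t : ℝ => t⁻¹ • (f (x + t • s • y) - f x)) (𝓝[≠] 0) (𝓝 b)) :
    b = s • a := by
  have hm : Tendsto (fun t : ℝ => t * s) (𝓝[≠] 0) (𝓝[≠] 0) := by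
    refine tendsto_nhdsWithin_iff.2 ⟨?_, ?_⟩
    · have : Tendsto (fun t : ℝ => t * s) (𝓝 0) (𝓝 (0 * s)) :=
        (continuous_id.mul continuous_const).tendsto 0
      rw [zero_mul] at this
      exact this.mono_left nhdsWithin_le_nhds
    · filter_upwards [self_mem_nhdsWithin] with t ht
      exact mul_ne_zero ht hs
  refine tendsto_nhds_unique hb (((ha.comp hm).const_smul s).congr fun t => ?_)
  simp only [Function.comp_apply, smul_smul, mul_inv]
  congr 1
  field_simp

/-- Used to see that `df j (0, 0) = 0`, so that a family of derivatives inherits the condition at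
`0` needed for forming its direct sum. -/
theorem directionalDeriv_zero {E F : Type*} [AddCommGroup E] [Module ℝ E] [AddCommGroup F]
    [Module ℝ F] [TopologicalSpace F] [T2Space F] {f : E → F} {x : E} {a : F}
    (ha : Tendsto (fun t : ℝ => t⁻¹ • (f (x + t • (0 : E)) - f x)) (𝓝[≠] 0) (𝓝 a)) : a = 0 := by
  refine tendsto_nhds_unique ha ?_
  simp

/-- A mean value estimate with respect to a continuous seminorm. -/
theorem seminorm_sub_le_of_directionalDeriv [IsTopologicalAddGroup E] [ContinuousSMul ℝ E]
    [IsTopologicalAddGroup F] {f : E → F} {V : Set E} (hf : ContinuousOn f V)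
    {df : E × E → F}
    (hdf : ∀ x ∈ V, ∀ y : E,
        Tendsto (fun t : ℝ => t⁻¹ • (f (x + t • y) - f x)) (𝓝[≠] 0) (𝓝 (df (x, y))))
    {p : Seminorm ℝ F} (hp : Continuous p) {y : E} {C : ℝ}
    (hy : ∀ t ∈ Icc (0 : ℝ) 1, t • y ∈ V) (hC : ∀ t ∈ Icc (0 : ℝ) 1, p (df (t • y, y)) ≤ C) :
    p (f y - f 0) ≤ C := by
  -- The real function `t ↦ p (f (t • y) - f 0)` need not be differentiable, but its right slopes
  -- are bounded by those of `p ∘ f` differences. Comparing it with `C * t` requires neither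
  -- integrals nor linear functionals on `F`.
  have key := image_le_of_liminf_slope_right_le_deriv_boundary
    (f := fun t : ℝ => p (f (t • y) - f 0)) (a := 0) (b := 1) (B := fun t => C * t)
    (B' := fun _ => C) ?_ (by simp) (by fun_prop) ?_ ?_
    (right_mem_Icc.2 zero_le_one)
  · simpa using key
  · refine hp.comp_continuousOn (ContinuousOn.sub (hf.comp ?_ hy) continuousOn_const)
    exact (continuous_id.smul continuous_const).continuousOn
  · intro x _
    simpa using ((hasDerivAt_id x).const_mul C).hasDerivWithinAt
  · intro x hx r hr
    have hx' : x ∈ Icc (0 : ℝ) 1 := ⟨hx.1, hx.2.le⟩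
    have hm : Tendsto (fun z : ℝ => z - x) (𝓝[>] x) (𝓝[≠] 0) := by
      refine tendsto_nhdsWithin_iff.2 ⟨?_, ?_⟩
      · have : Tendsto (fun z : ℝ => z - x) (𝓝 x) (𝓝 (x - x)) :=
          (continuous_id.sub continuous_const).tendsto x
        rw [sub_self] at this
        exact this.mono_left nhdsWithin_le_nhds
      · filter_upwards [self_mem_nhdsWithin] with t ht
        exact sub_ne_zero.2 (ne_of_gt ht)
    have h1 := (hp.tendsto _).comp ((hdf _ (hy x hx') y).comp hm)
    have h2 := h1.eventually (gt_mem_nhds ((hC x hx').trans_lt hr))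
    refine Eventually.frequently ?_
    filter_upwards [h2, self_mem_nhdsWithin] with z hz hxz
    have hxz' : 0 < z - x := sub_pos.2 hxz
    refine lt_of_le_of_lt ?_ hz
    simp only [Function.comp_apply, slope_def_field, map_smul_eq_mul, norm_inv, Real.norm_eq_abs,
      abs_of_pos hxz']
    rw [← add_smul, add_sub_cancel, div_eq_inv_mul]
    refine mul_le_mul_of_nonneg_left ?_ (inv_nonneg.2 hxz'.le)
    have : f (z • y) - f 0 = (f (z • y) - f (x • y)) + (f (x • y) - f 0) := by abel
    rw [this]
    linarith [map_add_le_add p (f (z • y) - f (x • y)) (f (x • y) - f 0)]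

/-- A `C^1`-map is Lipschitz at `0` with respect to suitable continuous seminorms. -/
theorem exists_seminorm_sub_le [IsTopologicalAddGroup E] [ContinuousSMul ℝ E]
    [LocallyConvexSpace ℝ E] [IsTopologicalAddGroup F] [ContinuousSMul ℝ F] [T2Space F]
    {f : E → F} {V : Set E} (hV : IsOpen V) (h0 : 0 ∈ V) (hf : ContinuousOn f V)
    {df : E × E → F}
    (hdf : ∀ x ∈ V, ∀ y : E,
        Tendsto (fun t : ℝ => t⁻¹ • (f (x + t • y) - f x)) (𝓝[≠] 0) (𝓝 (df (x, y))))
    (hc : ContinuousOn df (V ×ˢ univ)) {p : Seminorm ℝ F} (hp : Continuous p) :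
    ∃ q : Seminorm ℝ E, Continuous q ∧ ∀ y, q y < 1 → y ∈ V ∧ p (f y - f 0) ≤ q y := by
  have hz : df (0, 0) = 0 := directionalDeriv_zero (hdf 0 h0 0)
  have hn : {z | p (df z) < 1} ∈ 𝓝 ((0 : E), (0 : E)) := by
    have hcat : ContinuousAt df (0, 0) :=
      hc.continuousAt ((hV.prod isOpen_univ).mem_nhds ⟨h0, mem_univ _⟩)
    exact (hp.continuousAt.comp hcat).eventually (gt_mem_nhds (by simp [hz]))
  obtain ⟨U₁, hU₁, U₂, hU₂, hU⟩ := mem_nhds_prod_iff.1 hn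
  -- One `q` serves for membership in `V`, for base points and for directions.
  obtain ⟨q, hq, hqU⟩ := exists_continuous_seminorm_ball_subset
    (inter_mem (hV.mem_nhds h0) (inter_mem hU₁ hU₂))
  have hle : ∀ x y, q x < 1 → p (df (x, y)) ≤ q y := by
    intro x y hx
    -- Homogeneity of `df (x, ·)` turns the bound `1` on the unit ball of `q` into the bound `q y`.
    -- Rescaling by an arbitrary `s > q y` also covers `q y = 0`.
    refine le_of_forall_gt_imp_ge_of_dense fun s hs => ?_
    have hs0 : 0 < s := (apply_nonneg q y).trans_lt hs
    have hxV := (hqU x hx).1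
    have hb := hdf x hxV (s • s⁻¹ • y)
    have e := directionalDeriv_smul hs0.ne' (hdf x hxV (s⁻¹ • y)) hb
    rw [smul_inv_smul₀ hs0.ne'] at e
    rw [e, map_smul_eq_mul, Real.norm_eq_abs, abs_of_pos hs0]
    have hy : q (s⁻¹ • y) < 1 := by
      rw [map_smul_eq_mul, norm_inv, Real.norm_eq_abs, abs_of_pos hs0, ← div_eq_inv_mul]
      exact (div_lt_one hs0).2 hs
    have : p (df (x, s⁻¹ • y)) < 1 := hU ⟨(hqU x hx).2.1, (hqU _ hy).2.2⟩
    nlinarith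
  refine ⟨q, hq, fun y hy => ⟨(hqU y hy).1, ?_⟩⟩
  have ht : ∀ t ∈ Icc (0 : ℝ) 1, q (t • y) < 1 := fun t ht => by
    rw [map_smul_eq_mul, Real.norm_eq_abs, abs_of_nonneg ht.1]
    exact lt_of_le_of_lt (mul_le_of_le_one_left (apply_nonneg q y) ht.2) hy
  exact seminorm_sub_le_of_directionalDeriv hf hdf hp (fun t h => (hqU _ (ht t h)).1)
    fun t h => hle _ _ (ht t h)

end Bastiani

/-! ### Direct sums of maps -/

section DirectSumMaps

variable {J : Type w} {F : J → Type v} [∀ j, AddCommGroup (F j)] [∀ j, Module ℝ (F j)]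
  [∀ j, TopologicalSpace (F j)] [∀ j, IsTopologicalAddGroup (F j)]
  [∀ j, ContinuousSMul ℝ (F j)] [∀ j, T2Space (F j)]

open LCDirectSum

/-- A direct sum of `C^1`-maps, almost all of which fix `0`, is continuous. -/
theorem LCDirectSum.continuousOn_map {E : J → Type u} [∀ j, AddCommGroup (E j)]
    [∀ j, Module ℝ (E j)] [∀ j, TopologicalSpace (E j)] [∀ j, IsTopologicalAddGroup (E j)]
    [∀ j, ContinuousSMul ℝ (E j)] [∀ j, LocallyConvexSpace ℝ (E j)]
    {f : ∀ j, E j → F j} {V : ∀ j, Set (E j)} (hV : ∀ j, IsOpen (V j))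
    (h0 : ∀ᶠ j in cofinite, (0 : E j) ∈ V j ∧ f j 0 = 0) (hf : ∀ j, BastianiOn 1 (f j) (V j))
    {Θ : LCDirectSum E → LCDirectSum F}
    (hΘ : ∀ z, (∀ j, z j ∈ V j) → ∀ j, Θ z j = f j (z j)) :
    ContinuousOn Θ {z | ∀ j, z j ∈ V j} := by
  classical
  intro x hx
  refine tendsto_of_seminorm fun p hp => ?_
  have hpj : ∀ j, Continuous (p.comp (incl F j)) := fun j => hp.comp (continuous_incl F j)
  -- Plain continuity of `f j` suffices for the finitely many coordinates in `S`. For all others `x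
  -- j = 0 = f j (x j)`, and the Lipschitz estimate at `0` supplies `q j`. Setting `q j = 0` on `S`
  -- gives `sumSeminorm q x = 0`.
  have hS : {j | ¬ (((0 : E j) ∈ V j ∧ f j 0 = 0) ∧ x j = 0)}.Finite :=
    h0.and x.eventually_apply_eq_zero
  set S := hS.toFinset with hSdef
  have hnS : ∀ j, j ∉ S → ((0 : E j) ∈ V j ∧ f j 0 = 0) ∧ x j = 0 := fun j hj => by
    simpa only [hSdef, Finite.mem_toFinset, mem_ofPred_eq, not_not] using hj
  have hq : ∀ j, ∃ q : Seminorm ℝ (E j), Continuous q ∧ (j ∈ S → q = 0) ∧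
      (j ∉ S → ∀ y, q y < 1 → p.comp (incl F j) (f j y) ≤ q y) := by
    intro j
    by_cases hj : j ∈ S
    · exact ⟨0, continuous_const, fun _ => rfl, fun h => absurd hj h⟩
    · obtain ⟨hc, df, hdf, hdc⟩ := hf j
      obtain ⟨q, hq, h⟩ := exists_seminorm_sub_le (hV j) (hnS j hj).1.1 hc hdf hdc (hpj j)
      refine ⟨q, hq, fun h => absurd h hj, fun _ y hy => ?_⟩
      have := (h y hy).2
      rwa [(hnS j hj).1.2, sub_zero] at this
  choose q hq hqS hqle using hq
  have hQ := continuous_sumSeminorm hq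
  have hQx : sumSeminorm q x = 0 := by
    rw [sumSeminorm_apply]
    refine finsum_eq_zero_of_forall_eq_zero fun j => ?_
    by_cases hj : j ∈ S
    · rw [hqS j hj]; rfl
    · rw [(hnS j hj).2, map_zero]
  have hlim : Tendsto (fun z : LCDirectSum E =>
      ∑ j ∈ S, p.comp (incl F j) (f j (z j) - f j (x j)) + sumSeminorm q z)
      (𝓝[{z | ∀ j, z j ∈ V j}] x) (𝓝 0) := by
    have h1 : Tendsto (fun z : LCDirectSum E =>
        ∑ j ∈ S, p.comp (incl F j) (f j (z j) - f j (x j)))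
        (𝓝[{z | ∀ j, z j ∈ V j}] x) (𝓝 (∑ j ∈ S, 0)) := by
      refine tendsto_finsetSum _ fun j _ => Filter.Tendsto.seminorm_sub (hpj j) ?_
      have : ContinuousAt (f j) (x j) :=
        (hf j).continuousOn.continuousAt ((hV j).mem_nhds (hx j))
      exact (this.tendsto.comp (LCDirectSum.continuous_apply j).continuousAt).mono_left
        nhdsWithin_le_nhds
    have h2 := hQ.continuousAt (x := x)
    have h3 := h1.add (h2.tendsto.mono_left nhdsWithin_le_nhds)
    simpa [hQx] using h3
  have hev : ∀ᶠ z in 𝓝[{z : LCDirectSum E | ∀ j, z j ∈ V j}] x, sumSeminorm q z < 1 :=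
    mem_nhdsWithin_of_mem_nhds (hQ.continuousAt.eventually (gt_mem_nhds (by rw [hQx]; exact one_pos)))
  refine squeeze_zero' (Eventually.of_forall fun z => apply_nonneg _ _) ?_ hlim
  filter_upwards [hev, self_mem_nhdsWithin] with z hz hzV
  refine (le_sumSeminorm_comp_incl p _).trans ?_
  set T := S ∪ (Θ z - Θ x).finite_support.toFinset with hT
  rw [sumSeminorm_eq_sum _ (Θ z - Θ x) (s := T) fun j hj =>
    Finset.mem_union_right _ ((Finite.mem_toFinset _).2 hj)]
  -- The part over `S` is kept as it is; the part over `T \ S`, where `T` depends on `z`, is bounded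
  -- by `sumSeminorm q z` independently of `T`.
  rw [← Finset.sum_sdiff (Finset.subset_union_left : S ⊆ T), add_comm]
  have hco : ∀ j, (Θ z - Θ x) j = f j (z j) - f j (x j) := fun j => by
    rw [sub_apply, hΘ z hzV, hΘ x hx]
  refine add_le_add (Finset.sum_le_sum fun j _ => by rw [hco]) ?_
  refine le_trans (Finset.sum_le_sum fun j hj => ?_) (sum_le_sumSeminorm q z (T \ S))
  have hj' : j ∉ S := (Finset.mem_sdiff.1 hj).2
  rw [hco, (hnS j hj').2, (hnS j hj').1.2, sub_zero]
  exact hqle j hj' _ ((apply_le_sumSeminorm q z j).trans_lt hz)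

/-- A direct sum of `C^(n+1)`-maps, almost all of which fix `0`, is `C^n`. The additional continuous
linear map `L` gives access to the maps on products of direct sums. -/
theorem BastianiOn.directSum (n : ℕ) :
    ∀ {E : J → Type u} [∀ j, AddCommGroup (E j)] [∀ j, Module ℝ (E j)]
      [∀ j, TopologicalSpace (E j)] [∀ j, IsTopologicalAddGroup (E j)]
      [∀ j, ContinuousSMul ℝ (E j)] [∀ j, LocallyConvexSpace ℝ (E j)]
      {X : Type (max w u)} [AddCommGroup X] [Module ℝ X] [TopologicalSpace X]
      (L : X →L[ℝ] LCDirectSum E)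
      {f : ∀ j, E j → F j} {V : ∀ j, Set (E j)}, (∀ j, IsOpen (V j)) →
      (∀ᶠ j in cofinite, (0 : E j) ∈ V j ∧ f j 0 = 0) →
      (∀ j, BastianiOn (n + 1) (f j) (V j)) →
      ∀ {Θ : X → LCDirectSum F},
        (∀ x, (∀ j, L x j ∈ V j) → ∀ j, Θ x j = f j (L x j)) →
        BastianiOn n Θ {x | ∀ j, L x j ∈ V j} := by
  -- Continuity is needed at every stage of the induction. It uses one order of differentiability of
  -- the `f j`, whence the loss of one degree.
  have hcont : ∀ (n : ℕ) {E : J → Type u} [∀ j, AddCommGroup (E j)] [∀ j, Module ℝ (E j)]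
      [∀ j, TopologicalSpace (E j)] [∀ j, IsTopologicalAddGroup (E j)]
      [∀ j, ContinuousSMul ℝ (E j)] [∀ j, LocallyConvexSpace ℝ (E j)]
      {X : Type (max w u)} [AddCommGroup X] [Module ℝ X] [TopologicalSpace X]
      (L : X →L[ℝ] LCDirectSum E)
      {f : ∀ j, E j → F j} {V : ∀ j, Set (E j)}, (∀ j, IsOpen (V j)) →
      (∀ᶠ j in cofinite, (0 : E j) ∈ V j ∧ f j 0 = 0) →
      (∀ j, BastianiOn (n + 1) (f j) (V j)) →
      ∀ {Θ : X → LCDirectSum F},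
        (∀ x, (∀ j, L x j ∈ V j) → ∀ j, Θ x j = f j (L x j)) →
        ContinuousOn Θ {x | ∀ j, L x j ∈ V j} := by
    intro n E _ _ _ _ _ _ X _ _ _ L f V hV h0 hf Θ hΘ
    have hex : ∀ z : LCDirectSum E, ∃ z' : LCDirectSum F, ∀ j, z' j = f j (z j) := fun z =>
      exists_apply_eq ((h0.and z.eventually_apply_eq_zero).mono fun j hj => by
        rw [hj.2, hj.1.2])
    choose Ψ hΨ using hex
    have h1 : ∀ j, BastianiOn 1 (f j) (V j) := fun j => by
      obtain ⟨hc, df, hdf, hn⟩ := hf j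
      exact ⟨hc, df, hdf, hn.continuousOn⟩
    refine ((continuousOn_map hV h0 h1 fun z _ => hΨ z).comp L.continuous.continuousOn
      fun x hx => hx).congr fun x hx => ?_
    refine LCDirectSum.ext fun j => ?_
    rw [hΘ x hx, Function.comp_apply, hΨ]
  induction n with
  | zero =>
    intro E _ _ _ _ _ _ X _ _ _ L f V hV h0 hf Θ hΘ
    exact hcont 0 L hV h0 hf hΘ
  | succ n ih =>
    intro E _ _ _ _ _ _ X _ _ _ L f V hV h0 hf Θ hΘ
    refine ⟨hcont _ L hV h0 hf hΘ, ?_⟩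
    choose hc df hdf hn using hf
    obtain ⟨T, hT⟩ := exists_prod_continuousLinearMap (E := E) (E' := E)
    -- The derivative lives on `X × X`, which is not itself a direct sum. Composing with `L'`
    -- presents it as the direct sum of the `df j`, to which the induction hypothesis applies.
    let L' : X × X →L[ℝ] LCDirectSum (fun j => E j × E j) := T.comp (L.prodMap L)
    have hL' : ∀ x y j, L' (x, y) j = (L x j, L y j) := fun x y j => hT _ _ j
    have hdf0 : ∀ᶠ j in cofinite, ((0 : E j × E j) ∈ V j ×ˢ univ ∧ df j 0 = 0) :=
      h0.mono fun j hj => ⟨⟨hj.1, mem_univ _⟩, directionalDeriv_zero (hdf j 0 hj.1 0)⟩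
    have hex : ∀ p : X × X, ∃ z : LCDirectSum F, ∀ j, z j = df j (L' p j) := fun p =>
      exists_apply_eq ((hdf0.and (L' p).eventually_apply_eq_zero).mono fun j hj => by
        rw [hj.2, hj.1.2])
    choose dΘ hdΘ using hex
    refine ⟨dΘ, fun x hx y => ?_, ?_⟩
    · classical
      have hxt : ∀ᶠ t : ℝ in 𝓝[≠] 0, ∀ j, L (x + t • y) j ∈ V j := by
        have hL : Continuous fun t : ℝ => L x + t • L y := by fun_prop
        have : ∀ᶠ t : ℝ in 𝓝 0, ∀ j, (L x + t • L y) j ∈ V j :=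
          hL.continuousAt.preimage_mem_nhds
            ((isOpen_setOf_forall hV).mem_nhds (by simpa using hx))
        refine (this.filter_mono nhdsWithin_le_nhds).mono fun t ht j => ?_
        rw [map_add, map_smul]
        exact ht j
      -- For fixed `x` and `y`, the difference quotients for all small `t ≠ 0` and their limit are
      -- supported in this one finite set, so the limit may be taken in each summand.
      have hS : {j | ¬ (((0 : E j) ∈ V j ∧ f j 0 = 0) ∧ L x j = 0 ∧ L y j = 0 ∧
          df j (L' (x, y) j) = 0)}.Finite := by
        refine h0.and ((L x).eventually_apply_eq_zero.and ((L y).eventually_apply_eq_zero.and ?_))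
        exact (dΘ (x, y)).eventually_apply_eq_zero.mono fun j hj => by rwa [hdΘ] at hj
      have hnS : ∀ j, j ∉ hS.toFinset → ((0 : E j) ∈ V j ∧ f j 0 = 0) ∧ L x j = 0 ∧ L y j = 0 ∧
          df j (L' (x, y) j) = 0 := fun j hj => by
        simpa only [Finite.mem_toFinset, mem_ofPred_eq, not_not] using hj
      have hsum : Tendsto (fun t : ℝ => ∑ j ∈ hS.toFinset,
          incl F j (t⁻¹ • (f j (L x j + t • L y j) - f j (L x j)))) (𝓝[≠] 0)
          (𝓝 (∑ j ∈ hS.toFinset, incl F j (df j (L' (x, y) j)))) := by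
        refine tendsto_finsetSum _ fun j _ => ?_
        rw [hL']
        exact ((continuous_incl F j).tendsto _).comp (hdf j _ (hx j) _)
      have e1 : dΘ (x, y) = ∑ j ∈ hS.toFinset, incl F j (df j (L' (x, y) j)) := by
        rw [eq_sum_incl (dΘ (x, y)) (s := hS.toFinset)]
        · simp only [hdΘ]
        · intro j hj
          by_contra h
          exact hj (by rw [hdΘ, (hnS j h).2.2.2])
      rw [e1]
      refine hsum.congr' ?_
      filter_upwards [hxt] with t ht
      have hco : ∀ j, (t⁻¹ • (Θ (x + t • y) - Θ x)) j =
          t⁻¹ • (f j (L x j + t • L y j) - f j (L x j)) := fun j => by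
        rw [LCDirectSum.smul_apply, LCDirectSum.sub_apply, hΘ _ ht, hΘ _ hx, map_add, map_smul, LCDirectSum.add_apply,
          LCDirectSum.smul_apply]
      rw [eq_sum_incl (t⁻¹ • (Θ (x + t • y) - Θ x)) (s := hS.toFinset)]
      · simp only [hco]
      · intro j hj
        by_contra h
        refine hj ?_
        rw [hco, (hnS j h).2.1, (hnS j h).2.2.1]
        simp
    · have := ih L' (fun j => (hV j).prod isOpen_univ) hdf0 hn (Θ := dΘ) fun p _ j => hdΘ p j
      convert this using 1
      ext ⟨x, y⟩
      simp [hL']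

/-- A direct sum of smooth maps, almost all of which fix `0`, is smooth. -/
theorem BastianiSmoothOn.directSum {E : J → Type u} [∀ j, AddCommGroup (E j)]
    [∀ j, Module ℝ (E j)] [∀ j, TopologicalSpace (E j)] [∀ j, IsTopologicalAddGroup (E j)]
    [∀ j, ContinuousSMul ℝ (E j)] [∀ j, LocallyConvexSpace ℝ (E j)]
    {X : Type (max w u)} [AddCommGroup X] [Module ℝ X] [TopologicalSpace X]
    (L : X →L[ℝ] LCDirectSum E) {f : ∀ j, E j → F j} {V : ∀ j, Set (E j)}
    (hV : ∀ j, IsOpen (V j)) (h0 : ∀ᶠ j in cofinite, (0 : E j) ∈ V j ∧ f j 0 = 0)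
    (hf : ∀ j, BastianiSmoothOn (f j) (V j)) {Θ : X → LCDirectSum F}
    (hΘ : ∀ x, (∀ j, L x j ∈ V j) → ∀ j, Θ x j = f j (L x j)) :
    BastianiSmoothOn Θ {x | ∀ j, L x j ∈ V j} := fun n =>
  BastianiOn.directSum n L hV h0 (fun j => hf j (n + 1)) hΘ

end DirectSumMaps

/-! ### Completeness of weak direct products -/

namespace WeakDirectProduct

section Group

variable {J : Type w} {G : J → Type v} [∀ j, Group (G j)]

theorem ext {x y : WeakDirectProduct G} (h : ∀ j, x j = y j) : x = y :=
  Subtype.ext (funext h)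

@[simp] theorem one_apply (j : J) : (1 : WeakDirectProduct G) j = 1 := rfl

@[simp] theorem mul_apply (x y : WeakDirectProduct G) (j : J) : (x * y) j = x j * y j := rfl

@[simp] theorem inv_apply (x : WeakDirectProduct G) (j : J) : x⁻¹ j = (x j)⁻¹ := rfl

theorem eventually_apply_eq_one (x : WeakDirectProduct G) : ∀ᶠ j in cofinite, x j = 1 := x.2

theorem exists_apply_eq {g : ∀ j, G j} (h : ∀ᶠ j in cofinite, g j = 1) :
    ∃ x : WeakDirectProduct G, ∀ j, x j = g j :=
  ⟨⟨g, h⟩, fun _ => rfl⟩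

end Group

section Completeness

open LCDirectSum

variable {J : Type w} {E : J → Type u} {G : J → Type v}
  [∀ j, AddCommGroup (E j)] [∀ j, Module ℝ (E j)] [∀ j, TopologicalSpace (E j)]
  [∀ j, Group (G j)] [∀ j, TopologicalSpace (G j)]
  [TopologicalSpace (WeakDirectProduct G)]
  {φ : ∀ j, OpenPartialHomeomorph (G j) (E j)}
  {Φ : OpenPartialHomeomorph (WeakDirectProduct G) (LCDirectSum E)}

theorem chart_one (h1 : ∀ j, (1 : G j) ∈ (φ j).source ∧ φ j 1 = 0)
    (hs : Φ.source = {x | ∀ j, x j ∈ (φ j).source})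
    (hΦ : ∀ x ∈ Φ.source, ∀ j, Φ x j = φ j (x j)) : 1 ∈ Φ.source ∧ Φ 1 = 0 := by
  have h : (1 : WeakDirectProduct G) ∈ Φ.source := by
    rw [hs]
    exact fun j => (h1 j).1
  exact ⟨h, LCDirectSum.ext fun j => (hΦ 1 h j).trans (h1 j).2⟩

variable [∀ j, IsTopologicalAddGroup (E j)] [∀ j, ContinuousSMul ℝ (E j)]
  [∀ j, LocallyConvexSpace ℝ (E j)]

/-- In the chart `Φ` this is the openness of boxes in the direct sum. The factors `U j` may be
chosen independently for infinitely many `j`. -/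
theorem box_mem_nhds_one (h1 : ∀ j, (1 : G j) ∈ (φ j).source ∧ φ j 1 = 0)
    (hs : Φ.source = {x | ∀ j, x j ∈ (φ j).source})
    (hΦ : ∀ x ∈ Φ.source, ∀ j, Φ x j = φ j (x j))
    {U : ∀ j, Set (G j)} (hU : ∀ j, U j ∈ 𝓝 1) :
    {x : WeakDirectProduct G | ∀ j, x j ∈ U j} ∈ 𝓝 1 := by
  obtain ⟨m1, e1⟩ := chart_one h1 hs hΦ
  have hV : ∀ j, IsOpen ((φ j).target ∩ (φ j).symm ⁻¹' interior (U j)) := fun j =>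
    (φ j).isOpen_inter_preimage_symm isOpen_interior
  have h0 : {z : LCDirectSum E | ∀ j, z j ∈ (φ j).target ∩ (φ j).symm ⁻¹' interior (U j)} ∈
      𝓝 (Φ 1) := by
    refine (isOpen_setOf_forall hV).mem_nhds fun j => ?_
    rw [hΦ 1 m1]
    refine ⟨(φ j).map_source (h1 j).1, ?_⟩
    rw [mem_preimage, one_apply, (φ j).left_inv (h1 j).1]
    exact mem_interior_iff_mem_nhds.2 (hU j)
  filter_upwards [(Φ.continuousAt m1).preimage_mem_nhds h0, Φ.open_source.mem_nhds m1]
    with x hx hxs j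
  have hj := (hx j).2
  rw [mem_preimage, hΦ x hxs, (φ j).left_inv (by rw [hs] at hxs; exact hxs j)] at hj
  exact interior_subset hj

theorem tendsto_apply_one (h1 : ∀ j, (1 : G j) ∈ (φ j).source ∧ φ j 1 = 0)
    (hs : Φ.source = {x | ∀ j, x j ∈ (φ j).source})
    (hΦ : ∀ x ∈ Φ.source, ∀ j, Φ x j = φ j (x j)) (j : J) :
    Tendsto (fun x : WeakDirectProduct G => x j) (𝓝 1) (𝓝 1) := by
  classical
  intro U hU
  have := box_mem_nhds_one h1 hs hΦ (U := Function.update (fun _ => univ) j U) fun i => by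
    rcases eq_or_ne i j with rfl | h
    · simpa using hU
    · simp [Function.update_of_ne h]
  refine mem_map.2 (mem_of_superset this fun x hx => ?_)
  simpa using hx j

/-- The identity of a weak direct product has a basis of neighbourhoods which are closed in the
topology of coordinatewise convergence. -/
theorem exists_mem_nhds_one_forall_tendsto [∀ j, IsTopologicalGroup (G j)]
    (h1 : ∀ j, (1 : G j) ∈ (φ j).source ∧ φ j 1 = 0)
    (hs : Φ.source = {x | ∀ j, x j ∈ (φ j).source})
    (hΦ : ∀ x ∈ Φ.source, ∀ j, Φ x j = φ j (x j))
    {U : Set (WeakDirectProduct G)} (hU : U ∈ 𝓝 1) :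
    ∃ K ∈ 𝓝 (1 : WeakDirectProduct G), ∀ {B : Type*} (l : Filter B) [l.NeBot]
      (x : B → WeakDirectProduct G) (y : WeakDirectProduct G), (∀ᶠ b in l, x b ∈ K) →
      (∀ j, Tendsto (fun b => x b j) l (𝓝 (y j))) → y ∈ U := by
  obtain ⟨m1, e1⟩ := chart_one h1 hs hΦ
  have hsymm : Φ.symm ⁻¹' U ∈ 𝓝 (0 : LCDirectSum E) := by
    rw [← e1]
    refine (Φ.symm.continuousAt (Φ.map_source m1)).preimage_mem_nhds ?_
    rwa [Φ.left_inv m1]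
  obtain ⟨p, hp, hpU⟩ := exists_continuous_seminorm_ball_subset hsymm
  set q : ∀ j, Seminorm ℝ (E j) := fun j => p.comp (incl E j)
  have hq : ∀ j, Continuous (q j) := fun j => hp.comp (continuous_incl E j)
  -- Closed neighbourhoods inside the chart domains keep coordinatewise limits in the domain of `Φ`.
  choose A hA hAc hAs using fun j =>
    exists_mem_nhds_isClosed_subset ((φ j).open_source.mem_nhds (h1 j).1)
  have hKs : ∀ x : WeakDirectProduct G, (∀ j, x j ∈ A j) → x ∈ Φ.source := fun x hx => by
    rw [hs]
    exact fun j => hAs j (hx j)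
  -- Only a non-strict inequality survives the limit; `1 / 2` leaves room for the strict bound `p (Φ
  -- y) < 1`.
  refine ⟨{x | (∀ j, x j ∈ A j) ∧ sumSeminorm q (Φ x) ≤ 1 / 2}, inter_mem
    (box_mem_nhds_one h1 hs hΦ hA) ?_, fun l _ x y hx hy => ?_⟩
  · have hc : ContinuousAt (fun x => sumSeminorm q (Φ x)) 1 :=
      ContinuousAt.comp (continuous_sumSeminorm hq).continuousAt (Φ.continuousAt m1)
    have h0 : sumSeminorm q (Φ 1) < 1 / 2 := by simp [e1]
    exact (hc.eventually (gt_mem_nhds h0)).mono fun x h => le_of_lt h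
  · have hyA : ∀ j, y j ∈ A j := fun j =>
      (hAc j).mem_of_tendsto (hy j) (hx.mono fun b hb => hb.1 j)
    have hys := hKs y hyA
    have hle : sumSeminorm q (Φ y) ≤ 1 / 2 := by
      -- As `y` lies in the weak direct product, its seminorm is a sum over a fixed finite set. The
      -- corresponding partial sums for `x b` converge to it and are at most `1 / 2`.
      rw [sumSeminorm_eq_sum q (Φ y) (s := (Φ y).finite_support.toFinset)
        fun j hj => (Finite.mem_toFinset _).2 hj]
      refine le_of_tendsto (tendsto_finsetSum _ fun j _ =>
        (((hq j).tendsto (Φ y j)).comp ?_ : Tendsto (fun b => q j (φ j (x b j))) l _))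
        (hx.mono fun b hb => ?_)
      · rw [hΦ y hys]
        exact ((φ j).continuousAt (hAs j (hyA j))).tendsto.comp (hy j)
      · refine le_trans (le_of_eq ?_) ((sum_le_sumSeminorm q (Φ (x b))
          (Φ y).finite_support.toFinset).trans hb.2)
        exact Finset.sum_congr rfl fun j _ => by rw [Function.comp_apply, hΦ _ (hKs _ hb.1)]
    have hlt : p (Φ y) < 1 :=
      ((le_sumSeminorm_comp_incl p _).trans hle).trans_lt (by norm_num)
    have := hpU _ hlt
    rwa [mem_preimage, Φ.left_inv hys] at this

theorem isLeftCauchyNet_apply (h1 : ∀ j, (1 : G j) ∈ (φ j).source ∧ φ j 1 = 0)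
    (hs : Φ.source = {x | ∀ j, x j ∈ (φ j).source})
    (hΦ : ∀ x ∈ Φ.source, ∀ j, Φ x j = φ j (x j))
    {A : Type*} [Preorder A] {x : A → WeakDirectProduct G}
    (hx : IsLeftCauchyNet x) (j : J) : IsLeftCauchyNet fun α => x α j := fun _ hU =>
  hx _ (tendsto_apply_one h1 hs hΦ j hU)

variable [∀ j, IsTopologicalGroup (G j)] [∀ j, T2Space (G j)]
  [IsTopologicalGroup (WeakDirectProduct G)]

/-- A left Cauchy net in a weak direct product converges if all its coordinates converge. -/
theorem exists_tendsto_of_isLeftCauchyNet (h1 : ∀ j, (1 : G j) ∈ (φ j).source ∧ φ j 1 = 0)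
    (hs : Φ.source = {x | ∀ j, x j ∈ (φ j).source})
    (hΦ : ∀ x ∈ Φ.source, ∀ j, Φ x j = φ j (x j))
    {A : Type*} [Preorder A] [IsDirectedOrder A] [Nonempty A] {x : A → WeakDirectProduct G}
    (hx : IsLeftCauchyNet x)
    (hlim : ∀ j, ∃ g : G j, Tendsto (fun α => x α j) atTop (𝓝 g)) :
    ∃ z, Tendsto x atTop (𝓝 z) := by
  choose g hg using hlim
  have hfin : ∀ᶠ j in cofinite, g j = 1 := by
    -- Each closed `W j` excludes `g j` unless `g j = 1`. From some `γ` on, `x α` stays in `x γ`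
    -- times the box of the `W j`; wherever `x γ j = 1`, this puts `g j` into `W j`.
    have hW : ∀ j, ∃ W ∈ 𝓝 (1 : G j), IsClosed W ∧ (g j ∈ W → g j = 1) := by
      intro j
      by_cases h : g j = 1
      · exact ⟨univ, univ_mem, isClosed_univ, fun _ => h⟩
      · obtain ⟨W, hW, hWc, hWs⟩ := exists_mem_nhds_isClosed_subset
          (isOpen_compl_singleton.mem_nhds (show (1 : G j) ∈ {g j}ᶜ from fun h' => h h'.symm))
        exact ⟨W, hW, hWc, fun h' => absurd rfl (hWs h')⟩
    choose W hW hWc hWg using hW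
    obtain ⟨γ, hγ⟩ := hx _ (box_mem_nhds_one h1 hs hΦ hW)
    refine (x γ).eventually_apply_eq_one.mono fun j hj => hWg j ?_
    refine (hWc j).mem_of_tendsto (hg j) ((eventually_ge_atTop γ).mono fun α hα => ?_)
    simpa [hj] using hγ α γ hα le_rfl j
  obtain ⟨z, hz⟩ := exists_apply_eq hfin
  refine ⟨z, ?_⟩
  suffices h : Tendsto (fun α => z⁻¹ * x α) atTop (𝓝 1) by
    simpa using h.const_mul z
  intro U hU
  obtain ⟨K, hK, hKU⟩ := exists_mem_nhds_one_forall_tendsto h1 hs hΦ hU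
  obtain ⟨γ, hγ⟩ := hx K hK
  refine (eventually_ge_atTop γ).mono fun α hα => ?_
  -- With `α` fixed, the limit over `β` is taken coordinatewise; the choice of `K` places `z⁻¹ * x
  -- α` in `U`.
  refine hKU atTop (fun β => (x β)⁻¹ * x α) _
    ((eventually_ge_atTop γ).mono fun β hβ => hγ α β hα hβ) fun j => ?_
  simp only [mul_apply, inv_apply, hz]
  exact (hg j).inv.mul_const _

end Completeness

end WeakDirectProduct

theorem IsWeakDirectProductLieGroup.isLeftComplete_and_isLeftSeqComplete
    {J : Type w} {E : J → Type u} {G : J → Type v}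
    [∀ j, AddCommGroup (E j)] [∀ j, Module ℝ (E j)] [∀ j, TopologicalSpace (E j)]
    [∀ j, IsTopologicalAddGroup (E j)] [∀ j, ContinuousSMul ℝ (E j)]
    [∀ j, LocallyConvexSpace ℝ (E j)]
    [∀ j, Group (G j)] [∀ j, TopologicalSpace (G j)] [∀ j, ChartedSpace (E j) (G j)]
    (hG : ∀ j, IsLocallyConvexLieGroup (E j) (G j))
    [TopologicalSpace (WeakDirectProduct G)]
    [ChartedSpace (LCDirectSum E) (WeakDirectProduct G)]
    (h : IsWeakDirectProductLieGroup G E) :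
    ((∀ j, IsLeftComplete (G j)) → IsLeftComplete (WeakDirectProduct G)) ∧
      ((∀ j, IsLeftSeqComplete (G j)) → IsLeftSeqComplete (WeakDirectProduct G)) := by
  obtain ⟨φ, Φ, hφ, hs, -, hΦ, -⟩ := h.exists_chart
  have h1 : ∀ j, (1 : G j) ∈ (φ j).source ∧ φ j 1 = 0 := fun j => ⟨(hφ j).1, (hφ j).2.1⟩
  have := fun j => (hG j).t2
  have := fun j => (hG j).topologicalGroup
  have := h.isLieGroup.topologicalGroup
  constructor
  · intro hc A _ _ _ x hx
    exact WeakDirectProduct.exists_tendsto_of_isLeftCauchyNet h1 hs hΦ hx fun j =>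
      (hc j).exists_tendsto _ (WeakDirectProduct.isLeftCauchyNet_apply h1 hs hΦ hx j)
  · intro hc x hx
    exact WeakDirectProduct.exists_tendsto_of_isLeftCauchyNet h1 hs hΦ hx fun j =>
      hc j _ (WeakDirectProduct.isLeftCauchyNet_apply h1 hs hΦ hx j)

/-! ### Construction of weak direct products -/

/-- A group whose operations are continuous in charts is a topological group. -/
theorem isTopologicalGroup_of_charts {H M : Type*} [TopologicalSpace H] [TopologicalSpace M]
    [ChartedSpace H M] [Group M]
    (hmul : ∀ e₁ ∈ atlas H M, ∀ e₂ ∈ atlas H M, ∀ e₃ ∈ atlas H M,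
      IsOpen {p : H × H | p.1 ∈ e₁.target ∧ p.2 ∈ e₂.target ∧
        e₁.symm p.1 * e₂.symm p.2 ∈ e₃.source} ∧
      ContinuousOn (fun p : H × H => e₃ (e₁.symm p.1 * e₂.symm p.2))
        {p : H × H | p.1 ∈ e₁.target ∧ p.2 ∈ e₂.target ∧ e₁.symm p.1 * e₂.symm p.2 ∈ e₃.source})
    (hinv : ∀ e₁ ∈ atlas H M, ∀ e₂ ∈ atlas H M,
      IsOpen {v : H | v ∈ e₁.target ∧ (e₁.symm v)⁻¹ ∈ e₂.source} ∧
      ContinuousOn (fun v : H => e₂ (e₁.symm v)⁻¹)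
        {v : H | v ∈ e₁.target ∧ (e₁.symm v)⁻¹ ∈ e₂.source}) :
    IsTopologicalGroup M where
  continuous_mul := by
    rw [continuous_iff_continuousAt]
    rintro ⟨x, y⟩
    set e₁ := chartAt H x
    set e₂ := chartAt H y
    set e₃ := chartAt H (x * y)
    have hx : x ∈ e₁.source := mem_chart_source H x
    have hy : y ∈ e₂.source := mem_chart_source H y
    have hxy : x * y ∈ e₃.source := mem_chart_source H (x * y)
    obtain ⟨ho, hc⟩ := hmul e₁ (chart_mem_atlas H x) e₂ (chart_mem_atlas H y) e₃
      (chart_mem_atlas H (x * y))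
    have hm : (e₁ x, e₂ y) ∈ {p : H × H | p.1 ∈ e₁.target ∧ p.2 ∈ e₂.target ∧
        e₁.symm p.1 * e₂.symm p.2 ∈ e₃.source} :=
      ⟨e₁.map_source hx, e₂.map_source hy, by simpa [e₁.left_inv hx, e₂.left_inv hy] using hxy⟩
    have h12 : ContinuousAt (fun p : M × M => (e₁ p.1, e₂ p.2)) (x, y) :=
      ((e₁.continuousAt hx).comp continuousAt_fst).prodMk
        ((e₂.continuousAt hy).comp continuousAt_snd)
    have hF := ContinuousAt.comp (x := (x, y)) (hc.continuousAt (ho.mem_nhds hm)) h12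
    have h3 : ContinuousAt e₃.symm (e₃ (e₁.symm (e₁ x) * e₂.symm (e₂ y))) :=
      e₃.symm.continuousAt (e₃.map_source hm.2.2)
    refine (ContinuousAt.comp (x := (x, y)) h3 hF).congr ?_
    filter_upwards [h12.preimage_mem_nhds (ho.mem_nhds hm),
      (e₁.open_source.prod e₂.open_source).mem_nhds ⟨hx, hy⟩] with p hp hp'
    have h := e₃.left_inv hp.2.2
    simp only [Function.comp_apply]
    rw [h, e₁.left_inv hp'.1, e₂.left_inv hp'.2]
  continuous_inv := by
    rw [continuous_iff_continuousAt]
    intro x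
    set e₁ := chartAt H x
    set e₂ := chartAt H x⁻¹
    have hx : x ∈ e₁.source := mem_chart_source H x
    have hxi : x⁻¹ ∈ e₂.source := mem_chart_source H x⁻¹
    obtain ⟨ho, hc⟩ := hinv e₁ (chart_mem_atlas H x) e₂ (chart_mem_atlas H x⁻¹)
    have hm : e₁ x ∈ {v : H | v ∈ e₁.target ∧ (e₁.symm v)⁻¹ ∈ e₂.source} :=
      ⟨e₁.map_source hx, by simpa [e₁.left_inv hx] using hxi⟩
    have h1 := e₁.continuousAt hx
    have hF := ContinuousAt.comp (x := x) (hc.continuousAt (ho.mem_nhds hm)) h1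
    have h3 : ContinuousAt e₂.symm (e₂ (e₁.symm (e₁ x))⁻¹) :=
      e₂.symm.continuousAt (e₂.map_source hm.2)
    refine (ContinuousAt.comp (x := x) h3 hF).congr ?_
    filter_upwards [h1.preimage_mem_nhds (ho.mem_nhds hm), e₁.open_source.mem_nhds hx] with p hp hp'
    have h := e₂.left_inv hp.2
    simp only [Function.comp_apply]
    rw [h, e₁.left_inv hp']

/-! ### Charts of one Lie group, translated by a common vector. -/

section CenteredCharts

variable (E : Type u) [AddCommGroup E] [TopologicalSpace E] [IsTopologicalAddGroup E]
  (G : Type v) [Group G] [TopologicalSpace G] [ChartedSpace E G]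

/-- The charts of `G`, translated such that the preferred chart at `1` maps `1` to `0`. -/
def centeredAtlas : Set (OpenPartialHomeomorph G E) :=
  (fun e => e.transHomeomorph (Homeomorph.addRight (-(chartAt E (1 : G) 1)))) '' atlas E G

variable {G}

/-- The translate of the preferred chart at `x`. -/
noncomputable def centeredChartAt (x : G) : OpenPartialHomeomorph G E :=
  (chartAt E x).transHomeomorph (Homeomorph.addRight (-(chartAt E (1 : G) 1)))

theorem centeredChartAt_mem (x : G) : centeredChartAt E x ∈ centeredAtlas E G :=
  mem_image_of_mem _ (chart_mem_atlas E x)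

theorem mem_centeredChartAt_source (x : G) : x ∈ (centeredChartAt E x).source :=
  mem_chart_source E x

theorem centeredChartAt_one : centeredChartAt E (1 : G) 1 = 0 :=
  add_neg_cancel (chartAt E (1 : G) 1)

variable {E} [Module ℝ E] (h : IsLocallyConvexLieGroup E G)
include h

/-- Translating the charts alters their transition maps only by translations in source and target,
which `BastianiOn.translate` absorbs; the same holds for multiplication and inversion. -/
theorem IsLocallyConvexLieGroup.smooth_transition_centered :
    ∀ e ∈ centeredAtlas E G, ∀ e' ∈ centeredAtlas E G,
    BastianiSmoothOn (fun v : E => e' (e.symm v)) {v : E | v ∈ e.target ∧ e.symm v ∈ e'.source} := by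
  rintro _ ⟨e, he, rfl⟩ _ ⟨e', he', rfl⟩ n
  exact BastianiOn.translate n (h.smooth_transition e he e' he' n) _ _

theorem IsLocallyConvexLieGroup.smooth_mul_centered :
    ∀ e₁ ∈ centeredAtlas E G, ∀ e₂ ∈ centeredAtlas E G, ∀ e₃ ∈ centeredAtlas E G,
    BastianiSmoothOn (fun p : E × E => e₃ (e₁.symm p.1 * e₂.symm p.2))
      {p : E × E | p.1 ∈ e₁.target ∧ p.2 ∈ e₂.target ∧ e₁.symm p.1 * e₂.symm p.2 ∈ e₃.source} := by
  rintro _ ⟨e₁, h₁, rfl⟩ _ ⟨e₂, h₂, rfl⟩ _ ⟨e₃, h₃, rfl⟩ n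
  exact BastianiOn.translate n (h.smooth_mul e₁ h₁ e₂ h₂ e₃ h₃ n) (_, _) _

theorem IsLocallyConvexLieGroup.smooth_inv_centered :
    ∀ e₁ ∈ centeredAtlas E G, ∀ e₂ ∈ centeredAtlas E G,
    BastianiSmoothOn (fun v : E => e₂ (e₁.symm v)⁻¹)
      {v : E | v ∈ e₁.target ∧ (e₁.symm v)⁻¹ ∈ e₂.source} := by
  rintro _ ⟨e₁, h₁, rfl⟩ _ ⟨e₂, h₂, rfl⟩ n
  exact BastianiOn.translate n (h.smooth_inv e₁ h₁ e₂ h₂ n) _ _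

theorem IsLocallyConvexLieGroup.isSmoothDiffeo_centered :
    ∀ e ∈ centeredAtlas E G, IsSmoothDiffeo e := by
  rintro _ ⟨e, he, rfl⟩ e' he'
  refine ⟨fun n => ?_, fun n => ?_⟩
  · have := BastianiOn.translate n (h.smooth_transition e' he' e he n) 0
      (-(chartAt E (1 : G) 1))
    simp only [add_zero] at this
    exact this
  · have := BastianiOn.translate n (h.smooth_transition e he e' he' n)
      (-(-(chartAt E (1 : G) 1))) 0
    simp only [add_zero] at this
    exact this

end CenteredCharts

namespace WeakDirectProduct

/-! ### Direct sums of charts as an atlas of the weak direct product. -/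

open LCDirectSum

variable {J : Type w} (E : J → Type u) (G : J → Type v)
  [∀ j, AddCommGroup (E j)] [∀ j, TopologicalSpace (E j)] [∀ j, IsTopologicalAddGroup (E j)]
  [∀ j, Group (G j)] [∀ j, TopologicalSpace (G j)] [∀ j, ChartedSpace (E j) (G j)]

/-- Families of centered charts, almost all of which map `1` to `0`. -/
structure ChartFamily where
  /-- the members of the family -/
  chart : ∀ j, OpenPartialHomeomorph (G j) (E j)
  mem : ∀ j, chart j ∈ centeredAtlas (E j) (G j)
  pointed : ∀ᶠ j in cofinite, (1 : G j) ∈ (chart j).source ∧ chart j 1 = 0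

variable {E G}

theorem ChartFamily.pointed_symm (ψ : ChartFamily E G) :
    ∀ᶠ j in cofinite, (0 : E j) ∈ (ψ.chart j).target ∧ (ψ.chart j).symm 0 = 1 :=
  ψ.pointed.mono fun j hj =>
    ⟨hj.2 ▸ (ψ.chart j).map_source hj.1, hj.2 ▸ (ψ.chart j).left_inv hj.1⟩

variable (E) in
/-- The family of preferred charts at the coordinates of `x`. -/
noncomputable def ChartFamily.at (x : WeakDirectProduct G) : ChartFamily E G where
  chart j := centeredChartAt (E j) (x j)
  mem j := centeredChartAt_mem (E j) (x j)
  pointed := x.eventually_apply_eq_one.mono fun j hj => by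
    rw [hj]
    exact ⟨mem_centeredChartAt_source (E j) 1, centeredChartAt_one (E j)⟩

namespace ChartFamily

/-- For almost all `j` both `x j = 1` and `ψ.chart j 1 = 0`, so the image has finite support, even
when `x` lies outside the chart domain. -/
theorem exists_apply_eq (ψ : ChartFamily E G) (x : WeakDirectProduct G) :
    ∃ z : LCDirectSum E, ∀ j, z j = ψ.chart j (x j) :=
  LCDirectSum.exists_apply_eq ((ψ.pointed.and x.eventually_apply_eq_one).mono fun j hj => by
    rw [hj.2, hj.1.2])

theorem exists_symm_apply_eq (ψ : ChartFamily E G) (z : LCDirectSum E) :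
    ∃ x : WeakDirectProduct G, ∀ j, x j = (ψ.chart j).symm (z j) :=
  WeakDirectProduct.exists_apply_eq ((ψ.pointed_symm.and z.eventually_apply_eq_zero).mono
    fun j hj => by rw [hj.2, hj.1.2])

/-- The direct sum of a family of charts. -/
noncomputable def sum (ψ : ChartFamily E G) : PartialEquiv (WeakDirectProduct G) (LCDirectSum E) where
  toFun x := (ψ.exists_apply_eq x).choose
  invFun z := (ψ.exists_symm_apply_eq z).choose
  source := {x | ∀ j, x j ∈ (ψ.chart j).source}
  target := {z | ∀ j, z j ∈ (ψ.chart j).target}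
  map_source' x hx j := by
    rw [(ψ.exists_apply_eq x).choose_spec]
    exact (ψ.chart j).map_source (hx j)
  map_target' z hz j := by
    rw [(ψ.exists_symm_apply_eq z).choose_spec]
    exact (ψ.chart j).map_target (hz j)
  left_inv' x hx := WeakDirectProduct.ext fun j => by
    rw [(ψ.exists_symm_apply_eq _).choose_spec, (ψ.exists_apply_eq x).choose_spec]
    exact (ψ.chart j).left_inv (hx j)
  right_inv' z hz := LCDirectSum.ext fun j => by
    rw [(ψ.exists_apply_eq _).choose_spec, (ψ.exists_symm_apply_eq z).choose_spec]
    exact (ψ.chart j).right_inv (hz j)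

theorem sum_apply (ψ : ChartFamily E G) (x : WeakDirectProduct G) (j : J) :
    ψ.sum x j = ψ.chart j (x j) := (ψ.exists_apply_eq x).choose_spec j

theorem sum_symm_apply (ψ : ChartFamily E G) (z : LCDirectSum E) (j : J) :
    ψ.sum.symm z j = (ψ.chart j).symm (z j) := (ψ.exists_symm_apply_eq z).choose_spec j

theorem mem_sum_source (ψ : ChartFamily E G) (x : WeakDirectProduct G) :
    x ∈ ψ.sum.source ↔ ∀ j, x j ∈ (ψ.chart j).source := Iff.rfl

theorem mem_sum_target (ψ : ChartFamily E G) (z : LCDirectSum E) :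
    z ∈ ψ.sum.target ↔ ∀ j, z j ∈ (ψ.chart j).target := Iff.rfl

variable [∀ j, Module ℝ (E j)] [∀ j, ContinuousSMul ℝ (E j)] [∀ j, LocallyConvexSpace ℝ (E j)]
  [∀ j, T2Space (E j)]
  (hG : ∀ j, IsLocallyConvexLieGroup (E j) (G j))
include hG

/-- The transition map is the direct sum of the transition maps of the factors, and almost all of
these fix `0` because both families are pointed. -/
theorem smooth_transition (ψ ψ' : ChartFamily E G) :
    IsOpen {z : LCDirectSum E | z ∈ ψ.sum.target ∧ ψ.sum.symm z ∈ ψ'.sum.source} ∧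
    BastianiSmoothOn (fun z => ψ'.sum (ψ.sum.symm z))
      {z | z ∈ ψ.sum.target ∧ ψ.sum.symm z ∈ ψ'.sum.source} := by
  have hset : {z : LCDirectSum E | z ∈ ψ.sum.target ∧ ψ.sum.symm z ∈ ψ'.sum.source} =
      {z | ∀ j, z j ∈ {v | v ∈ (ψ.chart j).target ∧ (ψ.chart j).symm v ∈ (ψ'.chart j).source}} := by
    ext z
    simp only [mem_ofPred_eq, mem_sum_source, mem_sum_target, sum_symm_apply, forall_and]
  have ho : ∀ j, IsOpen
      {v | v ∈ (ψ.chart j).target ∧ (ψ.chart j).symm v ∈ (ψ'.chart j).source} := fun j =>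
    (ψ.chart j).isOpen_inter_preimage_symm (ψ'.chart j).open_source
  rw [hset]
  refine ⟨isOpen_setOf_forall ho, BastianiSmoothOn.directSum (ContinuousLinearMap.id ℝ _) ho
    (f := fun j v => ψ'.chart j ((ψ.chart j).symm v)) ?_
    (fun j => (hG j).smooth_transition_centered _ (ψ.mem j) _ (ψ'.mem j)) fun z _ j => ?_⟩
  · filter_upwards [ψ.pointed_symm, ψ'.pointed] with j h h'
    simp [h.1, h.2, h'.1, h'.2]
  · simp only [sum_apply, sum_symm_apply, ContinuousLinearMap.id_apply]

theorem smooth_mul (ψ₁ ψ₂ ψ₃ : ChartFamily E G) :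
    IsOpen {p : LCDirectSum E × LCDirectSum E | p.1 ∈ ψ₁.sum.target ∧ p.2 ∈ ψ₂.sum.target ∧
      ψ₁.sum.symm p.1 * ψ₂.sum.symm p.2 ∈ ψ₃.sum.source} ∧
    BastianiSmoothOn (fun p : LCDirectSum E × LCDirectSum E =>
      ψ₃.sum (ψ₁.sum.symm p.1 * ψ₂.sum.symm p.2))
      {p | p.1 ∈ ψ₁.sum.target ∧ p.2 ∈ ψ₂.sum.target ∧
        ψ₁.sum.symm p.1 * ψ₂.sum.symm p.2 ∈ ψ₃.sum.source} := by
  -- `L` regroups a pair of families into a family of pairs, so that multiplication becomes a direct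
  -- sum of maps on the `E j × E j`.
  obtain ⟨L, hL⟩ := exists_prod_continuousLinearMap (E := E) (E' := E)
  let V : ∀ j, Set (E j × E j) := fun j => {p | p.1 ∈ (ψ₁.chart j).target ∧
    p.2 ∈ (ψ₂.chart j).target ∧
    (ψ₁.chart j).symm p.1 * (ψ₂.chart j).symm p.2 ∈ (ψ₃.chart j).source}
  have hset : {p : LCDirectSum E × LCDirectSum E | p.1 ∈ ψ₁.sum.target ∧ p.2 ∈ ψ₂.sum.target ∧
      ψ₁.sum.symm p.1 * ψ₂.sum.symm p.2 ∈ ψ₃.sum.source} = {p | ∀ j, L p j ∈ V j} := by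
    ext ⟨z, z'⟩
    simp only [V, mem_ofPred_eq, mem_sum_source, mem_sum_target, mul_apply, sum_symm_apply,
      forall_and, hL]
  have ho : ∀ j, IsOpen (V j) := fun j => by
    have := (hG j).topologicalGroup
    have hc : ContinuousOn (fun p : E j × E j => (ψ₁.chart j).symm p.1 * (ψ₂.chart j).symm p.2)
        ((ψ₁.chart j).target ×ˢ (ψ₂.chart j).target) :=
      ((ψ₁.chart j).continuousOn_symm.comp continuousOn_fst fun p hp => hp.1).mul
        ((ψ₂.chart j).continuousOn_symm.comp continuousOn_snd fun p hp => hp.2)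
    have := hc.isOpen_inter_preimage ((ψ₁.chart j).open_target.prod (ψ₂.chart j).open_target)
      (ψ₃.chart j).open_source
    convert this using 1
    ext p
    simp [V, and_assoc]
  rw [hset]
  refine ⟨(isOpen_setOf_forall ho).preimage L.continuous, BastianiSmoothOn.directSum L ho
    (f := fun j p => ψ₃.chart j ((ψ₁.chart j).symm p.1 * (ψ₂.chart j).symm p.2)) ?_
    (fun j => (hG j).smooth_mul_centered _ (ψ₁.mem j) _ (ψ₂.mem j) _ (ψ₃.mem j)) ?_⟩
  · filter_upwards [ψ₁.pointed_symm, ψ₂.pointed_symm, ψ₃.pointed] with j h₁ h₂ h₃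
    simp [V, h₁.1, h₁.2, h₂.1, h₂.2, h₃.1, h₃.2]
  · rintro ⟨z, z'⟩ _ j
    simp only [sum_apply, mul_apply, sum_symm_apply, hL]

theorem smooth_inv (ψ₁ ψ₂ : ChartFamily E G) :
    IsOpen {z : LCDirectSum E | z ∈ ψ₁.sum.target ∧ (ψ₁.sum.symm z)⁻¹ ∈ ψ₂.sum.source} ∧
    BastianiSmoothOn (fun z => ψ₂.sum (ψ₁.sum.symm z)⁻¹)
      {z | z ∈ ψ₁.sum.target ∧ (ψ₁.sum.symm z)⁻¹ ∈ ψ₂.sum.source} := by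
  have hset : {z : LCDirectSum E | z ∈ ψ₁.sum.target ∧ (ψ₁.sum.symm z)⁻¹ ∈ ψ₂.sum.source} =
      {z | ∀ j, z j ∈
        {v | v ∈ (ψ₁.chart j).target ∧ ((ψ₁.chart j).symm v)⁻¹ ∈ (ψ₂.chart j).source}} := by
    ext z
    simp only [mem_ofPred_eq, mem_sum_source, mem_sum_target, inv_apply, sum_symm_apply, forall_and]
  have ho : ∀ j, IsOpen
      {v | v ∈ (ψ₁.chart j).target ∧ ((ψ₁.chart j).symm v)⁻¹ ∈ (ψ₂.chart j).source} := fun j => by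
    have := (hG j).topologicalGroup
    exact (ψ₁.chart j).continuousOn_symm.inv.isOpen_inter_preimage (ψ₁.chart j).open_target
      (ψ₂.chart j).open_source
  rw [hset]
  refine ⟨isOpen_setOf_forall ho, BastianiSmoothOn.directSum (ContinuousLinearMap.id ℝ _) ho
    (f := fun j v => ψ₂.chart j ((ψ₁.chart j).symm v)⁻¹) ?_
    (fun j => (hG j).smooth_inv_centered _ (ψ₁.mem j) _ (ψ₂.mem j)) fun z _ j => ?_⟩
  · filter_upwards [ψ₁.pointed_symm, ψ₂.pointed] with j h h'
    simp [h.1, h.2, h'.1, h'.2]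
  · simp only [sum_apply, inv_apply, sum_symm_apply, ContinuousLinearMap.id_apply]

end ChartFamily

variable [∀ j, Module ℝ (E j)] [∀ j, ContinuousSMul ℝ (E j)] [∀ j, LocallyConvexSpace ℝ (E j)]
  [∀ j, T2Space (E j)]
  (hG : ∀ j, IsLocallyConvexLieGroup (E j) (G j))

/-- The direct sums of charts define a charted space. -/
noncomputable def chartedSpaceCore : ChartedSpaceCore (LCDirectSum E) (WeakDirectProduct G) where
  atlas := range fun ψ : ChartFamily E G => ψ.sum
  chartAt x := (ChartFamily.at E x).sum
  mem_chart_source x j := mem_centeredChartAt_source (E j) (x j)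
  chart_mem_atlas x := mem_range_self _
  open_source := by
    rintro _ _ ⟨ψ, rfl⟩ ⟨ψ', rfl⟩
    exact (ψ.smooth_transition hG ψ').1
  continuousOn_toFun := by
    rintro _ _ ⟨ψ, rfl⟩ ⟨ψ', rfl⟩
    exact (ψ.smooth_transition hG ψ').2 0

include hG in
/-- The weak direct product of a family of Lie groups exists. -/
theorem exists_isWeakDirectProductLieGroup :
    ∃ (_ : TopologicalSpace (WeakDirectProduct G))
      (_ : ChartedSpace (LCDirectSum E) (WeakDirectProduct G)),
      IsWeakDirectProductLieGroup G E := by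
  let := (chartedSpaceCore hG).toTopologicalSpace
  let := (chartedSpaceCore hG).toChartedSpace
  let chart (ψ : ChartFamily E G) : OpenPartialHomeomorph (WeakDirectProduct G) (LCDirectSum E) :=
    (chartedSpaceCore hG).openPartialHomeomorph ψ.sum (mem_range_self ψ)
  have hatlas : ∀ e ∈ atlas (LCDirectSum E) (WeakDirectProduct G), ∃ ψ, e = chart ψ := by
    intro e he
    obtain ⟨_, ⟨e', rfl⟩, _, ⟨⟨ψ, rfl⟩, rfl⟩, h⟩ := he
    exact ⟨ψ, h⟩
  have htop : IsTopologicalGroup (WeakDirectProduct G) := by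
    refine isTopologicalGroup_of_charts (H := LCDirectSum E) ?_ ?_
    · intro e₁ h₁ e₂ h₂ e₃ h₃
      obtain ⟨ψ₁, rfl⟩ := hatlas e₁ h₁
      obtain ⟨ψ₂, rfl⟩ := hatlas e₂ h₂
      obtain ⟨ψ₃, rfl⟩ := hatlas e₃ h₃
      have := ψ₁.smooth_mul hG ψ₂ ψ₃
      -- Smoothness at order `0` is continuity.
      exact ⟨this.1, this.2 0⟩
    · intro e₁ h₁ e₂ h₂
      obtain ⟨ψ₁, rfl⟩ := hatlas e₁ h₁
      obtain ⟨ψ₂, rfl⟩ := hatlas e₂ h₂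
      have := ψ₁.smooth_inv hG ψ₂
      exact ⟨this.1, this.2 0⟩
  -- Continuous coordinates inject the weak direct product into the full product, which yields the
  -- Hausdorff property.
  have hcont : ∀ j, Continuous fun x : WeakDirectProduct G => x j := by
    intro j
    rw [continuous_iff_continuousAt]
    intro x
    set ψ := ChartFamily.at E x
    have hx : x ∈ (chart ψ).source := fun i => mem_centeredChartAt_source (E i) (x i)
    have hz : (chart ψ x) j ∈ (ψ.chart j).target := (chart ψ).map_source hx j
    refine (ContinuousAt.comp (x := x) (f := fun y => (chart ψ y) j) (g := (ψ.chart j).symm)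
      ((ψ.chart j).symm.continuousAt hz) (ContinuousAt.comp (x := x) (f := chart ψ)
        (LCDirectSum.continuous_apply j).continuousAt ((chart ψ).continuousAt hx))).congr ?_
    filter_upwards [(chart ψ).open_source.mem_nhds hx] with y hy
    exact (congrArg (ψ.chart j).symm (ψ.sum_apply y j)).trans ((ψ.chart j).left_inv (hy j))
  have ht2 : T2Space (WeakDirectProduct G) := by
    have := fun j => (hG j).t2
    exact T2Space.of_injective_continuous (f := fun (x : WeakDirectProduct G) j => x j)
      Subtype.val_injective (continuous_pi hcont)
  -- The required chart is the family at the identity, where every member, not only almost every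
  -- one, maps `1` to `0`.
  refine ⟨inferInstance, inferInstance, ⟨ht2, htop, ?_, ?_, ?_⟩,
    fun j => centeredChartAt (E j) 1, chart (ChartFamily.at E 1), fun j => ⟨?_, ?_, ?_⟩,
    rfl, rfl, fun x _ j => (ChartFamily.at E 1).sum_apply x j, fun e he => ?_⟩
  · intro e he e' he'
    obtain ⟨ψ, rfl⟩ := hatlas e he
    obtain ⟨ψ', rfl⟩ := hatlas e' he'
    exact (ψ.smooth_transition hG ψ').2
  · intro e₁ h₁ e₂ h₂ e₃ h₃
    obtain ⟨ψ₁, rfl⟩ := hatlas e₁ h₁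
    obtain ⟨ψ₂, rfl⟩ := hatlas e₂ h₂
    obtain ⟨ψ₃, rfl⟩ := hatlas e₃ h₃
    exact (ψ₁.smooth_mul hG ψ₂ ψ₃).2
  · intro e₁ h₁ e₂ h₂
    obtain ⟨ψ₁, rfl⟩ := hatlas e₁ h₁
    obtain ⟨ψ₂, rfl⟩ := hatlas e₂ h₂
    exact (ψ₁.smooth_inv hG ψ₂).2
  · exact mem_centeredChartAt_source (E j) 1
  · exact centeredChartAt_one (E j)
  · exact (hG j).isSmoothDiffeo_centered _ (centeredChartAt_mem (E j) 1)
  · obtain ⟨ψ, rfl⟩ := hatlas e he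
    exact ⟨(ψ.smooth_transition hG _).2, ((ChartFamily.at E 1).smooth_transition hG ψ).2⟩

end WeakDirectProduct

theorem theoremB {J : Type w} (E : J → Type u) (G : J → Type v)
    [∀ j, AddCommGroup (E j)] [∀ j, Module ℝ (E j)] [∀ j, TopologicalSpace (E j)]
    [∀ j, IsTopologicalAddGroup (E j)] [∀ j, ContinuousSMul ℝ (E j)]
    [∀ j, LocallyConvexSpace ℝ (E j)] [∀ j, T2Space (E j)]
    [∀ j, Group (G j)] [∀ j, TopologicalSpace (G j)] [∀ j, ChartedSpace (E j) (G j)]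
    (hG : ∀ j, IsLocallyConvexLieGroup (E j) (G j)) :
    (∃ (_ : TopologicalSpace (WeakDirectProduct G))
        (_ : ChartedSpace (LCDirectSum E) (WeakDirectProduct G)),
        IsWeakDirectProductLieGroup G E) ∧
    ∀ (_ : TopologicalSpace (WeakDirectProduct G))
      (_ : ChartedSpace (LCDirectSum E) (WeakDirectProduct G)),
      IsWeakDirectProductLieGroup G E →
        ((∀ j, IsLeftComplete (G j)) → IsLeftComplete (WeakDirectProduct G)) ∧
        ((∀ j, IsLeftSeqComplete (G j)) → IsLeftSeqComplete (WeakDirectProduct G)) := by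
  exact ⟨WeakDirectProduct.exists_isWeakDirectProductLieGroup hG,
    fun _ _ h => h.isLeftComplete_and_isLeftSeqComplete hG⟩
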